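/- Let $C_m$ and $P_m$ denote the cycle and the path with $m$ vertices, and set $G_3=C_8$, $G_2=P_7$, $G_1=P_5$ and $G_0=P_3$. For a positive integer $k$ and graphs $G,H_1,\dots,H_k$, let $gr_k(G:H_1,\dots,H_k)$ be the minimum integer $N$ such that for every $n\ge N$, every coloring of the edges of $K_n$ with colors from $\{1,\dots,k\}$ contains either a rainbow copy of $G$ (a copy whose edges have pairwise distinct colors) or, for some $j$, a monochromatic copy of $H_j$ in color $j$ (copies are subgraphs, not necessarily induced). Then for every $k\ge 1$ and all integers $i_1,\dots,i_k$ with $0\le i_j\le 3$ for $1\le j\le k$, \[ gr_k(K_3:G_{i_1},G_{i_2},\dots,G_{i_k})\ \le\ \sum_{j=1}^k i_j+5. \] -/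

import Mathlib

open scoped SimpleGraph

/-- The coloring `c` contains a rainbow copy of `G`: a copy of `G` in the complete graph all of
whose edges receive pairwise distinct colors. -/
def HasRainbowCopy {U V K : Type*} (G : SimpleGraph U)
    (c : SimpleGraph.TopEdgeLabeling V K) : Prop :=
  ∃ f : SimpleGraph.Copy G (⊤ : SimpleGraph V),
    Function.Injective (SimpleGraph.EdgeLabeling.pullback c f.toHom)

/-- The coloring `c` contains a monochromatic copy of `H` in the color `a`. -/
def HasMonoCopy {W V K : Type*} (H : SimpleGraph W)
    (c : SimpleGraph.TopEdgeLabeling V K) (a : K) : Prop :=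
  H ⊑ c.labelGraph a

/-- `N` has the Gallai-Ramsey property for `G` and `H₁, …, H_k`: for every `n ≥ N`, every
coloring of the edges of `K_n` with at most `k` colors contains a rainbow copy of `G` or,
for some color `j`, a monochromatic copy of `H_j` in color `j`. -/
def GallaiRamseyProp {U : Type*} (G : SimpleGraph U) {k : ℕ} {W : Fin k → Type*}
    (H : (j : Fin k) → SimpleGraph (W j)) (N : ℕ) : Prop :=
  ∀ n : ℕ, N ≤ n → ∀ c : SimpleGraph.TopEdgeLabeling (Fin n) (Fin k),
    HasRainbowCopy G c ∨ ∃ j : Fin k, HasMonoCopy (H j) c j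

/-- The Gallai-Ramsey number `gr_k(G : H₁, …, H_k)`: the minimum `N` with the Gallai-Ramsey
property (and `⊤` if there is no such `N`). -/
noncomputable def gallaiRamsey {U : Type*} (G : SimpleGraph U) {k : ℕ} {W : Fin k → Type*}
    (H : (j : Fin k) → SimpleGraph (W j)) : ℕ∞ :=
  sInf ((fun N : ℕ => (N : ℕ∞)) '' {N : ℕ | GallaiRamseyProp G H N})

/-- The orders of the graphs `P₃, P₅, P₇, C₈`. -/
def targetOrder : Fin 4 → ℕ
  | 0 => 3
  | 1 => 5
  | 2 => 7
  | 3 => 8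

/-- The graphs `G₀ = P₃`, `G₁ = P₅`, `G₂ = P₇`, `G₃ = C₈`, where `P_m` is the path with `m`
vertices and `C_m` the cycle with `m` vertices. -/
def targetGraph : (i : Fin 4) → SimpleGraph (Fin (targetOrder i))
  | 0 => SimpleGraph.pathGraph 3
  | 1 => SimpleGraph.pathGraph 5
  | 2 => SimpleGraph.pathGraph 7
  | 3 => SimpleGraph.cycleGraph 8

/-!
Suppose that the bound fails for a coloring with the smallest possible sum `N` of the indices, on at
least `N + 5` vertices and without rainbow triangles. The argument has three ingredients.

* *Modules.* A set `D` of vertices is a module if every outside vertex sees it in one color. If `D`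
  is a proper module with at least four vertices, then color `j` can be used by at most `i j` outside
  vertices, because a path in `D` alternates with vertices joined to all of `D`. Lowering the indices
  by these numbers gives a smaller counterexample on `D` (`exists_target_of_isModule`). So all
  proper modules have at most three vertices.

* *Two colors.* At most two colors `r`, `b` have a connected graph (`exists_not_preconnected`; this
  is the connectivity form of Gallai's theorem), and the components of any other color are modules,
  hence small. Intersecting modules have a module as their union, so the vertices split into classes
  of at most three vertices, and between different classes only the colors `r` and `b` occur
  (`GallaiColoring.equivalence_close`, `GallaiColoring.preconnected_of_not_close`).

* *Two-color Ramsey numbers with uncolored parts.* It remains to show `r + b + 5` vertices suffice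
  for two colors, if edges inside classes may be uncolored (`PartColored.exists_target`). Without
  uncolored edges these are the Ramsey numbers of `P₃`, `P₅`, `C₈` in pairs, which are bounded by a
  case analysis whose certificate is checked in the kernel (`exists_target_of_two_colors`). Otherwise
  let `D` be a class with an uncolored edge. By induction, there is a target graph in red after all
  edges inside `D` are made red, and likewise in blue. If the index is at most one, then `D` has few
  red neighbors (`card_add_card_le`). If it is three, then the cycle through `D` can be rerouted
  unless `D` has several blue neighbors, and enough neighbors in one color close a monochromatic
  cycle (`Sides.five_le_card_add_card`, `Sides.false_of_filled_cycle`). Counting neighbors of `D`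
  gives a contradiction. Finally, `P₇` reduces to `C₈`: add a vertex with red edges to all others.
-/

namespace GallaiRamsey
open SimpleGraph

/-! ### Paths and the cycle on eight vertices as lists -/

section Lists

variable {V : Type*} {H : SimpleGraph V}

lemma pathGraph_isContained_iff {m : ℕ} :
    pathGraph m ⊑ H ↔ ∃ p : List V, p.Nodup ∧ p.IsChain H.Adj ∧ p.length = m := by
  constructor
  · rintro ⟨f⟩
    refine ⟨List.ofFn f, List.nodup_ofFn.2 f.injective, ?_, by simp⟩
    rw [List.isChain_iff_getElem]
    intro i hi
    simp only [List.length_ofFn] at hi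
    simp only [List.getElem_ofFn]
    exact f.toHom.map_adj (pathGraph_adj.2 (Or.inl rfl))
  · rintro ⟨p, hn, hc, rfl⟩
    rw [List.isChain_iff_getElem] at hc
    refine ⟨⟨⟨fun i => p[i], ?_⟩, fun i j hij => ?_⟩⟩
    · intro a b hab
      rcases pathGraph_adj.1 hab with h | h
      · have := hc a (by omega)
        simpa [h] using this
      · have := (hc b (by omega)).symm
        simpa [h] using this
    · exact Fin.ext ((hn.getElem_inj_iff).1 hij)

lemma cycleGraph_eight_isContained {p : List V} (hn : p.Nodup) (hc : p.IsChain H.Adj)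
    (hl : p.length = 8) (hadj : H.Adj p[7] p[0]) : cycleGraph 8 ⊑ H := by
  rw [List.isChain_iff_getElem] at hc
  have key : ∀ a b : Fin 8, a - b = 1 → H.Adj p[b] p[a] := by
    intro a b hab
    have ha : a = b + 1 := by rw [← hab]; abel
    subst ha
    by_cases hb : b = 7
    · subst hb; exact hadj
    · have h1 : ((b + 1 : Fin 8) : ℕ) = b + 1 := by
        revert hb; revert b; decide
      have := hc b (by omega)
      simpa [h1] using this
  refine ⟨⟨⟨fun i : Fin 8 => p[i], ?_⟩, fun i j hij => ?_⟩⟩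
  · intro a b hab
    rcases cycleGraph_adj.1 hab with h | h
    · exact (key _ _ h).symm
    · exact key _ _ h
  · exact Fin.ext ((hn.getElem_inj_iff).1 hij)

lemma exists_of_cycleGraph_eight_isContained (h : cycleGraph 8 ⊑ H) :
    ∃ f : Fin 8 → V, Function.Injective f ∧ ∀ i, H.Adj (f i) (f (i + 1)) := by
  obtain ⟨f⟩ := h
  exact ⟨f, f.injective, fun i => f.toHom.map_adj (cycleGraph_adj.2 (Or.inr (by simp)))⟩

lemma targetGraph_isContained_iff_of_le_two {i : Fin 4} (hi : (i : ℕ) ≤ 2) :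
    targetGraph i ⊑ H ↔ pathGraph (2 * (i : ℕ) + 3) ⊑ H := by
  fin_cases i <;> first | exact Iff.rfl | (simp at hi)

/-- Let every vertex of `xs` be adjacent to all vertices of `D`. A path `d :: p` that starts in
`D` grows at its beginning by the vertices of `xs`, alternating with those of `ws ⊆ D`. -/
lemma exists_path_extension {D : Set V} : ∀ (xs ws : List V) (d : V) (p : List V),
    xs.length = ws.length → (∀ x ∈ xs, ∀ w ∈ D, H.Adj x w) → (∀ w ∈ ws, w ∈ D) → d ∈ D →
    (d :: p).IsChain H.Adj →
    ∃ e q, e ∈ D ∧ (e :: q).IsChain H.Adj ∧ (e :: q).Perm (xs ++ ws ++ d :: p) ∧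
      (e :: q).getLast (by simp) = (d :: p).getLast (by simp)
  | [], [], d, p, _, _, _, hd, hc => ⟨d, p, hd, hc, by simp, rfl⟩
  | x :: xs, w :: ws, d, p, hl, hx, hw, hd, hc => by
    obtain ⟨e, q, he, hq, hperm, hlast⟩ := exists_path_extension xs ws w (x :: d :: p)
      (by simpa using hl) (fun y hy => hx y (by simp [hy])) (fun y hy => hw y (by simp [hy]))
      (hw w (by simp))
      (by
        simp only [List.isChain_cons_cons]
        exact ⟨(hx x (by simp) w (hw w (by simp))).symm, hx x (by simp) d hd, hc⟩)
    refine ⟨e, q, he, hq, hperm.trans ?_, ?_⟩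
    · classical
      rw [List.perm_iff_count]
      intro a
      simp [List.count_cons]
      omega
    · rw [hlast]; simp

/-- If a path of `D` has `l` vertices and all vertices of `xs` are adjacent to all of `D`, then the
path extends to one that uses `xs`, has `l + 2 * xs.length` vertices and both ends in `D`. -/
lemma exists_path_of_join {D : Finset V} {xs p : List V} (hxs : xs.Nodup)
    (hxD : ∀ x ∈ xs, x ∉ D) (hadj : ∀ x ∈ xs, ∀ d ∈ D, H.Adj x d) (hp : p.Nodup)
    (hc : p.IsChain H.Adj) (hpD : ∀ v ∈ p, v ∈ D) (hne : p ≠ [])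
    (hcard : xs.length + p.length ≤ D.card) :
    ∃ q : List V, ∃ hq : q ≠ [], q.Nodup ∧ q.IsChain H.Adj ∧ q.length = p.length + 2 * xs.length ∧
      q.head hq ∈ D ∧ q.getLast hq ∈ D ∧ ∀ v ∈ q, v ∈ xs ∨ v ∈ D := by
  classical
  obtain ⟨d, p, rfl⟩ := List.exists_cons_of_ne_nil hne
  have hsub : (d :: p).toFinset ⊆ D := fun v hv => hpD v (by simpa using hv)
  have hc1 : xs.length ≤ (D \ (d :: p).toFinset).card := by
    rw [Finset.card_sdiff_of_subset hsub, List.toFinset_card_of_nodup hp]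
    omega
  obtain ⟨W, hWD, hWc⟩ := Finset.exists_subset_card_eq hc1
  have hW : ∀ w ∈ W.toList, w ∈ D ∧ w ∉ d :: p := fun w hw => by
    have := hWD (Finset.mem_toList.1 hw)
    rw [Finset.mem_sdiff, List.mem_toFinset] at this
    exact this
  obtain ⟨e, q, he, hq, hperm, hlast⟩ := exists_path_extension (H := H) (D := (D : Set V)) xs
    W.toList d p (by simp [hWc]) hadj (fun w hw => (hW w hw).1) (hpD d (by simp)) hc
  refine ⟨e :: q, by simp, ?_, hq, ?_, he, ?_, ?_⟩
  · rw [hperm.nodup_iff, List.nodup_append, List.nodup_append]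
    refine ⟨⟨hxs, W.nodup_toList, ?_⟩, hp, ?_⟩
    · rintro a ha b hb rfl
      exact hxD a ha (hW a hb).1
    · rintro a ha b hb rfl
      rcases List.mem_append.1 ha with h | h
      · exact hxD a h (hpD a hb)
      · exact (hW a h).2 hb
  · rw [hperm.length_eq]
    simp [hWc]
    omega
  · rw [hlast]
    exact hpD _ (List.getLast_mem _)
  · intro v hv
    rcases List.mem_append.1 (hperm.mem_iff.1 hv) with h | h
    · rcases List.mem_append.1 h with h | h
      · exact Or.inl h
      · exact Or.inr (hW v h).1
    · exact Or.inr (hpD v h)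

/-- The graph `G_i` arises from a path on `l` vertices in `D` by adding `t` vertices, each of them
adjacent to all of `D`, provided that `l + 2 * t = 2 * i + 3` and `D` is large enough. The cycle
`C₈` has `i = 3`: a path on seven vertices with ends in `D` is closed by the last vertex. -/
lemma targetGraph_isContained_of_join {D X : Finset V} (hDX : ∀ x ∈ X, x ∉ D)
    (hadj : ∀ x ∈ X, ∀ d ∈ D, H.Adj x d) {i : Fin 4} {p : List V} (hp : p.Nodup)
    (hc : p.IsChain H.Adj) (hpD : ∀ v ∈ p, v ∈ D) (hne : p ≠ []) {t : ℕ} (ht : t ≤ X.card)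
    (ht0 : 1 ≤ t) (hl : p.length + 2 * t = 2 * (i : ℕ) + 3)
    (hcard : t + p.length ≤ D.card + (i : ℕ) / 3) : targetGraph i ⊑ H := by
  classical
  obtain ⟨Y, hYX, hYc⟩ := Finset.exists_subset_card_eq ht
  by_cases hi : (i : ℕ) ≤ 2
  · have : (i : ℕ) / 3 = 0 := by omega
    obtain ⟨q, -, hqn, hqc, hql, -⟩ := exists_path_of_join (H := H) (xs := Y.toList) (p := p)
      Y.nodup_toList (fun x hx => hDX x (hYX (by simpa using hx)))
      (fun x hx => hadj x (hYX (by simpa using hx))) hp hc hpD hne (by simp [hYc]; omega)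
    rw [targetGraph_isContained_iff_of_le_two hi, pathGraph_isContained_iff]
    refine ⟨q, hqn, hqc, ?_⟩
    rw [hql]
    simp [hYc]
    omega
  · obtain rfl : i = 3 := by omega
    have h3 : ((3 : Fin 4) : ℕ) = 3 := rfl
    rw [h3] at hl hcard
    obtain ⟨y, hy⟩ : Y.Nonempty := Finset.card_pos.1 (by omega)
    have hlen : (Y.erase y).toList.length = t - 1 := by simp [Finset.card_erase_of_mem hy, hYc]
    obtain ⟨q, hq, hqn, hqc, hql, hqh, hqL, hqm⟩ := exists_path_of_join (H := H)
      (xs := (Y.erase y).toList) (p := p)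
      (Finset.nodup_toList _) (fun x hx => hDX x (hYX (Finset.mem_of_mem_erase (by simpa using hx))))
      (fun x hx => hadj x (hYX (Finset.mem_of_mem_erase (by simpa using hx)))) hp hc hpD hne
      (by rw [hlen]; omega)
    have hq7 : q.length = 7 := by rw [hql, hlen]; omega
    refine cycleGraph_eight_isContained (p := y :: q) ?_ ?_ (by simp [hq7]) ?_
    · refine List.nodup_cons.2 ⟨fun h => ?_, hqn⟩
      rcases hqm y h with h | h
      · simp at h
      · exact hDX y (hYX hy) h
    · rw [List.isChain_cons]
      refine ⟨fun z hz => ?_, hqc⟩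
      rw [List.head?_eq_some_head hq, Option.mem_some_iff] at hz
      exact hz ▸ hadj y (hYX hy) _ hqh
    · have : (y :: q)[7]'(by simp [hq7]) = q.getLast hq := by
        rw [List.getLast_eq_getElem]
        simp [hq7]
      rw [this]
      exact (hadj y (hYX hy) _ hqL).symm

end Lists

/-! ### Gallai colorings, modules and color classes -/

/-- An edge coloring of the complete graph on `V` without rainbow triangles, given by a symmetric
function of two vertices; its values on the diagonal carry no meaning. -/
structure GallaiColoring (V K : Type*) where
  /-- The color of an edge. -/
  col : V → V → K
  symm : ∀ u v, col u v = col v u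
  gallai : ∀ x y z, x ≠ y → y ≠ z → x ≠ z →
    col x y = col y z ∨ col y z = col x z ∨ col x y = col x z

namespace GallaiColoring

variable {V K : Type*} (c : GallaiColoring V K)

/-- The graph formed by the edges of color `a`. -/
def graph (a : K) : SimpleGraph V where
  Adj u v := u ≠ v ∧ c.col u v = a
  symm := ⟨fun u v h => ⟨h.1.symm, (c.symm v u).trans h.2⟩⟩
  loopless := ⟨fun _ h => h.1 rfl⟩

lemma graph_adj {a : K} {u v : V} : (c.graph a).Adj u v ↔ u ≠ v ∧ c.col u v = a := Iff.rfl

/-- The restriction of a coloring to a set of vertices. -/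
def restrict (s : Set V) : GallaiColoring s K where
  col u v := c.col u v
  symm u v := c.symm u v
  gallai x y z hxy hyz hxz :=
    c.gallai x y z (Subtype.coe_ne_coe.2 hxy) (Subtype.coe_ne_coe.2 hyz) (Subtype.coe_ne_coe.2 hxz)

lemma restrict_graph_adj {s : Set V} {a : K} {u v : s} :
    ((c.restrict s).graph a).Adj u v ↔ (c.graph a).Adj u v := by
  simp [graph_adj, restrict, Subtype.ext_iff]

lemma restrict_graph_isContained (s : Set V) (a : K) : (c.restrict s).graph a ⊑ c.graph a :=
  ⟨⟨⟨Subtype.val, fun h => c.restrict_graph_adj.1 h⟩, Subtype.val_injective⟩⟩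

/-- A set of vertices is a module if every vertex outside it sends edges of one color to it. -/
def IsModule (D : Finset V) : Prop :=
  ∀ w ∉ D, ∀ d ∈ D, ∀ d' ∈ D, c.col w d = c.col w d'

/-- Two vertices in one component of the color `a` look the same from every vertex outside that
component: along an edge `x y` of color `a`, the triangle `w x y` forces equal colors. -/
lemma col_eq_of_reachable {a : K} {x y w : V} (hxy : (c.graph a).Reachable x y)
    (hw : ¬ (c.graph a).Reachable x w) : c.col w x = c.col w y := by
  obtain ⟨p⟩ := hxy
  induction p with
  | nil => rfl
  | @cons u v z huv q ih =>
    have hvw : ¬ (c.graph a).Reachable v w := fun h => hw (huv.reachable.trans h)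
    rw [← ih hvw]
    have hwu : w ≠ u := fun h => hw (h ▸ Reachable.refl _)
    have hwv : w ≠ v := fun h => hvw (h ▸ Reachable.refl _)
    have h1 : c.col w u ≠ a := fun h =>
      hw (Adj.reachable (c.graph_adj.2 ⟨hwu.symm, (c.symm _ _).trans h⟩))
    have h2 : c.col w v ≠ a := fun h =>
      hvw (Adj.reachable (c.graph_adj.2 ⟨hwv.symm, (c.symm _ _).trans h⟩))
    have h3 := huv.2
    rcases c.gallai w u v hwu huv.1 hwv with h | h | h
    · exact absurd (h.trans h3) h1
    · exact absurd (h.symm.trans h3) h2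
    · exact h

open Classical in
/-- A component of a disconnected color class is a module. -/
lemma isModule_reachable [Fintype V] (a : K) (x : V) :
    c.IsModule (Finset.univ.filter fun y => (c.graph a).Reachable x y) := by
  intro w hw d hd d' hd'
  simp only [Finset.mem_filter, Finset.mem_univ, true_and] at hw hd hd'
  exact c.col_eq_of_reachable (hd.symm.trans hd') fun h => hw (hd.trans h)

/-- Two modules that meet have a module as their union. -/
lemma IsModule.union [DecidableEq V] {D E : Finset V} (hD : c.IsModule D) (hE : c.IsModule E)
    {z : V} (hzD : z ∈ D) (hzE : z ∈ E) : c.IsModule (D ∪ E) := by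
  intro w hw d hd d' hd'
  rw [Finset.mem_union, not_or] at hw
  have key : ∀ d ∈ D ∪ E, c.col w d = c.col w z := by
    intro d hd
    rcases Finset.mem_union.1 hd with h | h
    · exact hD w hw.1 d h z hzD
    · exact hE w hw.2 d h z hzE
  rw [key d hd, key d' hd']

/-- The inductive step for `exists_not_preconnected`: after the deletion of `v` the color `a`
becomes disconnected. Every component of `a` is joined to `v` in color `a`, hence an edge of color
`d` from `v` to `u` forces the color `d` between the component of `u` and the other components. -/
lemma false_of_preconnected {a d e : K} (hda : d ≠ a) (hea : e ≠ a) (hde : d ≠ e) (v : V)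
    (ha : (c.graph a).Preconnected) (hd : (c.graph d).Preconnected)
    (he : (c.graph e).Preconnected)
    (hv : ¬ ((c.restrict {w | w ≠ v}).graph a).Preconnected) : False := by
  set c' := c.restrict {w | w ≠ v} with hc'
  have hcomp : ∀ u : {w | w ≠ v}, ∃ w, (c'.graph a).Reachable u w ∧ c.col v w = a := by
    intro u
    obtain ⟨p⟩ := ha u v
    obtain ⟨⟨⟨s, t⟩, hst⟩, -, ⟨s', hs', rfl⟩, ht⟩ := p.exists_boundary_dart
      (Subtype.val '' {t : {w | w ≠ v} | (c'.graph a).Reachable u t}) ⟨u, Reachable.refl _, rfl⟩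
      (fun ⟨t, _, h⟩ => t.2 h)
    refine ⟨s', hs', ?_⟩
    by_cases htv : t = v
    · subst htv
      exact (c.symm _ _).trans hst.2
    · exact absurd ⟨⟨t, htv⟩, Reachable.trans hs'
        (Adj.reachable (c.restrict_graph_adj.2 hst)), rfl⟩ ht
  have hforce : ∀ {b : K}, b ≠ a → (c.graph b).Preconnected → ∃ u : {w | w ≠ v},
      ∀ w, ¬ (c'.graph a).Reachable u w → c.col w u = b := by
    intro b hba hb
    have hex : ∃ u : {w | w ≠ v}, c.col v u = b := by
      obtain ⟨x, -⟩ : ∃ x : {w | w ≠ v}, True := by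
        by_contra h
        exact hv fun x => absurd ⟨x, trivial⟩ h
      obtain ⟨p⟩ := hb v x
      obtain ⟨⟨⟨s, t⟩, hst⟩, -, rfl, ht⟩ := p.exists_boundary_dart {v} rfl x.2
      exact ⟨⟨t, ht⟩, hst.2⟩
    obtain ⟨u, hu⟩ := hex
    refine ⟨u, fun w hw => ?_⟩
    obtain ⟨w', hw', hvw'⟩ := hcomp w
    have huw' : ¬ (c'.graph a).Reachable u w' := fun h => hw (h.trans hw'.symm)
    have hne : (u : V) ≠ w' := fun h => huw' (Subtype.ext h ▸ Reachable.refl _)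
    have hna : c.col u w' ≠ a := fun h =>
      huw' (Adj.reachable (c.restrict_graph_adj.2 (c.graph_adj.2 ⟨hne, h⟩)))
    have h1 : c.col u w' = b := by
      rcases c.gallai v u w' (Ne.symm u.2) hne (Ne.symm w'.2) with h | h | h
      · exact h.symm.trans hu
      · exact absurd (h.trans hvw') hna
      · exact absurd (hu.symm.trans (h.trans hvw')) hba
    have h2 : c.col u w = c.col u w' :=
      c'.col_eq_of_reachable (w := u) hw' fun h => hw h.symm
    rw [c.symm, h2, h1]
  obtain ⟨u, hu⟩ := hforce hda hd
  obtain ⟨t, ht⟩ := hforce hea he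
  by_cases hut : (c'.graph a).Reachable u t
  · obtain ⟨w, hw⟩ : ∃ w, ¬ (c'.graph a).Reachable u w := by
      by_contra h
      push Not at h
      exact hv fun x y => (h x).symm.trans (h y)
    have := c'.col_eq_of_reachable hut hw
    exact hde ((hu w hw).symm.trans (this.trans (ht w fun h => hw (hut.trans h))))
  · have h1 := hu t hut
    have h2 := ht u fun h => hut h.symm
    exact hde (h1.symm.trans ((c.symm _ _).trans h2))

end GallaiColoring

/-- Of three colors of a Gallai coloring, one does not connect the vertex set. -/
theorem exists_not_preconnected {K : Type*} {a b d : K} (hab : a ≠ b) (hbd : b ≠ d) (had : a ≠ d) :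
    ∀ (n : ℕ) (V : Type) [Fintype V] (c : GallaiColoring V K), Fintype.card V = n + 2 →
      (c.graph a).Preconnected → (c.graph b).Preconnected → (c.graph d).Preconnected → False := by
  classical
  intro n
  induction n with
  | zero =>
    intro V _ c hV ha hb _
    obtain ⟨x, y, hxy, huniv⟩ := Finset.card_eq_two.1 (Finset.card_univ.trans hV)
    have key : ∀ {e : K}, (c.graph e).Preconnected → c.col x y = e := by
      intro e he
      obtain ⟨p⟩ := he x y
      obtain ⟨⟨⟨s, t⟩, hst⟩, -, rfl, ht⟩ := p.exists_boundary_dart {x} rfl hxy.symm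
      obtain rfl : t = y := by
        have := Finset.mem_univ t
        rw [huniv, Finset.mem_insert, Finset.mem_singleton] at this
        exact this.resolve_left ht
      exact hst.2
    exact hab ((key ha).symm.trans (key hb))
  | succ n ih =>
    intro V _ c hV ha hb hd
    obtain ⟨v⟩ : Nonempty V := Fintype.card_pos_iff.1 (by omega)
    have hcard : Fintype.card {w | w ≠ v} = n + 2 :=
      (Set.card_ne_eq v).trans (by omega)
    by_cases h1 : ((c.restrict {w | w ≠ v}).graph a).Preconnected
    · by_cases h2 : ((c.restrict {w | w ≠ v}).graph b).Preconnected
      · by_cases h3 : ((c.restrict {w | w ≠ v}).graph d).Preconnected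
        · exact ih _ _ hcard h1 h2 h3
        · exact c.false_of_preconnected had hbd hab v hd ha hb h3
      · exact c.false_of_preconnected hab hbd.symm had v hb ha hd h2
    · exact c.false_of_preconnected hab.symm had.symm hbd v ha hb hd h1

/-! ### Modules of a minimal counterexample -/

/-- If `D` is a module with at least four vertices, other than the whole vertex set, and the bound
holds for all smaller sums of indices, then it holds for the coloring `c`. The vertices outside `D`
are joined to `D` in one color each. Either some color `j` is used by more than `i j` of them, and
then these vertices and `D` span `G_{i j}` in color `j`, or the induction hypothesis applies to `D`
with the indices lowered by the number of vertices of each color. -/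
lemma exists_target_of_isModule {K : Type*} [Fintype K] {V : Type} [Fintype V]
    (c : GallaiColoring V K) (i : K → Fin 4)
    (hV : (∑ j, (i j : ℕ)) + 5 ≤ Fintype.card V)
    (ih : ∀ (W : Type) [Fintype W] (c' : GallaiColoring W K) (i' : K → Fin 4),
      (∑ j, (i' j : ℕ)) < ∑ j, (i j : ℕ) → (∑ j, (i' j : ℕ)) + 5 ≤ Fintype.card W →
      ∃ j, targetGraph (i' j) ⊑ c'.graph j)
    {D : Finset V} (hD : c.IsModule D) (hne : D ≠ Finset.univ) (hD4 : 4 ≤ D.card) :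
    ∃ j, targetGraph (i j) ⊑ c.graph j := by
  classical
  obtain ⟨d₀, hd₀⟩ : D.Nonempty := Finset.card_pos.1 (by omega)
  set X : K → Finset V := fun j => Dᶜ.filter fun w => c.col w d₀ = j with hX
  have hsum : ∑ j, (X j).card = Dᶜ.card :=
    (Finset.card_eq_sum_card_fiberwise fun _ _ => Finset.mem_coe.2 (Finset.mem_univ _)).symm
  have hXD : ∀ j, ∀ x ∈ X j, x ∉ D := fun j x hx =>
    Finset.mem_compl.1 (Finset.mem_filter.1 hx).1
  have hadj : ∀ j, ∀ x ∈ X j, ∀ d ∈ D, (c.graph j).Adj x d := fun j x hx d hd =>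
    ⟨fun h => hXD j x hx (h ▸ hd), (hD x (hXD j x hx) d hd d₀ hd₀).trans (Finset.mem_filter.1 hx).2⟩
  by_cases hbig : ∃ j, (i j : ℕ) + 1 ≤ (X j).card
  · obtain ⟨j, hj⟩ := hbig
    refine ⟨j, targetGraph_isContained_of_join (hXD j) (hadj j) (p := [d₀]) (by simp) (by simp)
      (by simpa using hd₀) (by simp) hj (by omega) ?_ ?_⟩
    · simp only [List.length_singleton]
      omega
    · simp only [List.length_singleton]
      omega
  · push Not at hbig
    have hcompl : 0 < Dᶜ.card := Finset.card_pos.2 <| by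
      rw [Finset.nonempty_iff_ne_empty, ne_eq, Finset.compl_eq_empty_iff]
      exact hne
    have hDV : Dᶜ.card + D.card = Fintype.card V := by
      rw [add_comm]; exact Finset.card_add_card_compl D
    set i' : K → Fin 4 := fun j => ⟨(i j : ℕ) - (X j).card, by omega⟩ with hi'
    have hi'j : ∀ j, (i' j : ℕ) + (X j).card = i j := fun j => by
      have := hbig j
      simp only [hi']
      omega
    have hsum' : ∑ j, (i' j : ℕ) + Dᶜ.card = ∑ j, (i j : ℕ) := by
      rw [← hsum, ← Finset.sum_add_distrib]
      exact Finset.sum_congr rfl fun j _ => hi'j j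
    obtain ⟨j, hj⟩ := ih (D : Set V) (c.restrict D) i' (by omega) (by
      have hDc : Fintype.card (D : Set V) = D.card := by simp
      omega)
    refine ⟨j, ?_⟩
    have hj' := hi'j j
    by_cases h0 : (X j).card = 0
    · have : i' j = i j := Fin.ext (by omega)
      exact this ▸ hj.trans (c.restrict_graph_isContained D j)
    · have h2 : (i' j : ℕ) ≤ 2 := by omega
      rw [targetGraph_isContained_iff_of_le_two h2, pathGraph_isContained_iff] at hj
      obtain ⟨p, hpn, hpc, hpl⟩ := hj
      have hle : (i' j : ℕ) ≤ ∑ j, (i' j : ℕ) :=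
        Finset.single_le_sum (f := fun j => (i' j : ℕ)) (fun _ _ => Nat.zero_le _)
          (Finset.mem_univ j)
      refine targetGraph_isContained_of_join (hXD j) (hadj j) (p := p.map Subtype.val)
        (hpn.map Subtype.val_injective) ?_ ?_ ?_ le_rfl (by omega) ?_ ?_
      · exact List.isChain_map_of_isChain _ (fun a b h => c.restrict_graph_adj.1 h) hpc
      · intro v hv
        obtain ⟨w, -, rfl⟩ := List.mem_map.1 hv
        exact w.2
      · intro h
        simp [← List.length_eq_zero_iff, hpl] at h
      · rw [List.length_map, hpl]
        omega
      · rw [List.length_map, hpl]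
        omega

/-! ### Two-color Ramsey numbers by a verified case analysis -/

/-- A small graph on the vertices `0, …, order - 1`, given by a list of edges. -/
structure Pattern where
  /-- The number of vertices. -/
  order : ℕ
  /-- The edges. -/
  edges : List (ℕ × ℕ)

/-- The pattern occurs in `H`: its vertices can be sent injectively to vertices of `H` such that
edges go to edges. -/
def Pattern.OccursIn {V : Type*} (P : Pattern) (H : SimpleGraph V) : Prop :=
  ∃ f : ℕ → V, Set.InjOn f {v | v < P.order} ∧ ∀ e ∈ P.edges, H.Adj (f e.1) (f e.2)

/-- The path with `m` vertices. -/
def Pattern.path (m : ℕ) : Pattern := ⟨m, (List.range (m - 1)).map fun v => (v, v + 1)⟩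

/-- The cycle with `m` vertices. -/
def Pattern.cycle (m : ℕ) : Pattern := ⟨m, (m - 1, 0) :: (Pattern.path m).edges⟩

/-- The cycle with seven vertices together with additional edges; the edges may use two further
vertices `7` and `8`, of which only the first `m - 7` belong to the pattern. -/
def Pattern.cycleSeven (m : ℕ) (es : List (ℕ × ℕ)) : Pattern :=
  ⟨m, es ++ (Pattern.cycle 7).edges⟩

/-- A case analysis over the colors of the edges of a complete graph whose vertices are numbers
less than `16`. -/
inductive CaseTree
  /-- Distinguish whether the edge `u v` is red (first subtree) or blue (second subtree). -/
  | split (u v : ℕ) (red blue : CaseTree)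
  /-- The red edges found so far contain the forbidden red pattern with number `k`; the list `vs`
  holds the vertices of its copy. -/
  | red (k : ℕ) (vs : List ℕ)
  /-- The blue edges found so far contain the forbidden blue pattern with number `k`; the list `vs`
  holds the vertices of its copy. -/
  | blue (k : ℕ) (vs : List ℕ)

/-- The set of edges with the edge `u v` added. A set of edges is a bit mask in which the edge
`u v` occupies the bits `16 * u + v` and `16 * v + u`. -/
def insertEdge (S u v : ℕ) : ℕ := S ||| 2 ^ (16 * u + v) ||| 2 ^ (16 * v + u)

/-- The bit mask of a list of edges. -/
def edgeMask : List (ℕ × ℕ) → ℕ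
  | [] => 0
  | e :: es => insertEdge (edgeMask es) e.1 e.2

/-- The test that `vs` lists the vertices of a copy of the pattern with edges in the set `S`. -/
def Pattern.occursCheck (P : Pattern) (n S : ℕ) (vs : List ℕ) : Bool :=
  Nat.beq vs.length P.order && decide vs.Nodup && vs.all (fun v => Nat.blt v n) &&
    P.edges.all fun e => S.testBit (16 * vs.getD e.1 0 + vs.getD e.2 0)

/-- The test that the case analysis is complete: every branch ends in a forbidden pattern. The
lists `FR` and `FB` hold the forbidden red and blue patterns, the masks `R` and `B` the red and
blue edges of the current branch, and `n` is the number of vertices. -/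
def CaseTree.check (n : ℕ) (FR FB : List Pattern) (R B : ℕ) : CaseTree → Bool
  | .split u v r b => Nat.blt u n && Nat.blt v n && !Nat.beq u v &&
      r.check n FR FB (insertEdge R u v) B && b.check n FR FB R (insertEdge B u v)
  | .red k vs => match FR[k]? with
    | none => false
    | some P => P.occursCheck n R vs
  | .blue k vs => match FB[k]? with
    | none => false
    | some P => P.occursCheck n B vs

/-- The edges of the pattern join vertices less than `P.order`, which is at most `n`. -/
def Pattern.wellFormed (P : Pattern) (n : ℕ) : Bool :=
  Nat.ble P.order n && P.edges.all fun e => Nat.blt e.1 P.order && Nat.blt e.2 P.order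

/-- The test for a chain of case analyses. A step `(P, t)` starts from a red copy of `P` on the
vertices `0, 1, …`. After the step, `P` is a forbidden red pattern. -/
def checkRed (n : ℕ) (FR FB : List Pattern) : List (Pattern × CaseTree) → Bool
  | [] => true
  | (P, t) :: l => P.wellFormed n && t.check n FR FB (edgeMask P.edges) 0 &&
      checkRed n (FR ++ [P]) FB l

/-- The test for a chain of case analyses with the same forbidden patterns `F` in both colors. A
step `(P, t)` starts from a red copy of `P` on the vertices `0, 1, …`. By symmetry `P` is a
forbidden pattern in both colors after the step. -/
def checkBoth (n : ℕ) (F : List Pattern) : List (Pattern × CaseTree) → Bool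
  | [] => true
  | (P, t) :: l => P.wellFormed n && t.check n F F (edgeMask P.edges) 0 && checkBoth n (F ++ [P]) l

section Soundness

variable {V : Type*} {Red Blue H : SimpleGraph V} {n : ℕ} {g : ℕ → V}

/-- The edges of the set `S` are edges of `H` when `v` stands for the vertex `g v`. -/
def Represents (g : ℕ → V) (S : ℕ) (H : SimpleGraph V) : Prop :=
  ∀ k, S.testBit k → H.Adj (g (k / 16)) (g (k % 16))

lemma Represents.insertEdge {S u v : ℕ} (h : Represents g S H) (hu : u < 16) (hv : v < 16)
    (huv : H.Adj (g u) (g v)) : Represents g (insertEdge S u v) H := by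
  intro k hk
  simp only [GallaiRamsey.insertEdge, Nat.testBit_or, Bool.or_eq_true, Nat.testBit_two_pow,
    decide_eq_true_eq] at hk
  rcases hk with (hk | rfl) | rfl
  · exact h k hk
  · rwa [show (16 * u + v) / 16 = u by omega, show (16 * u + v) % 16 = v by omega]
  · rw [show (16 * v + u) / 16 = v by omega, show (16 * v + u) % 16 = u by omega]
    exact huv.symm

lemma represents_zero : Represents g 0 H := fun k hk => by simp at hk

lemma represents_edgeMask : ∀ {es : List (ℕ × ℕ)}, (∀ e ∈ es, e.1 < 16 ∧ e.2 < 16) →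
    (∀ e ∈ es, H.Adj (g e.1) (g e.2)) → Represents g (edgeMask es) H
  | [], _, _ => represents_zero
  | e :: es, h, h' => (represents_edgeMask (fun x hx => h x (by simp [hx]))
      (fun x hx => h' x (by simp [hx]))).insertEdge (h e (by simp)).1 (h e (by simp)).2
      (h' e (by simp))

lemma Pattern.edge_lt_of_wellFormed {P : Pattern} (h : P.wellFormed n) :
    ∀ e ∈ P.edges, e.1 < P.order ∧ e.2 < P.order := by
  simp only [Pattern.wellFormed, Bool.and_eq_true, List.all_eq_true, Nat.blt_eq] at h
  exact h.2

lemma Pattern.order_le_of_wellFormed {P : Pattern} (h : P.wellFormed n) : P.order ≤ n := by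
  simp only [Pattern.wellFormed, Bool.and_eq_true, Nat.ble_eq] at h
  exact h.1

lemma Pattern.occursIn_of_check {P : Pattern} {S : ℕ} {vs : List ℕ} (hn : n ≤ 16)
    (hP : ∀ e ∈ P.edges, e.2 < P.order) (hg : Set.InjOn g {v | v < n})
    (hS : Represents g S H) (h : P.occursCheck n S vs) : P.OccursIn H := by
  simp only [Pattern.occursCheck, Bool.and_eq_true, List.all_eq_true, Nat.blt_eq,
    decide_eq_true_eq, Nat.beq_eq] at h
  obtain ⟨⟨⟨h1, h2⟩, h3⟩, h4⟩ := h
  have hlt : ∀ v < P.order, vs.getD v 0 < n := fun v hv => by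
    rw [List.getD_eq_getElem _ _ (h1 ▸ hv)]
    exact h3 _ (List.getElem_mem _)
  refine ⟨fun v => g (vs.getD v 0), fun u hu v hv he => ?_, fun e he => ?_⟩
  · have := hg (hlt u hu) (hlt v hv) he
    rw [List.getD_eq_getElem _ _ (h1 ▸ hu), List.getD_eq_getElem _ _ (h1 ▸ hv)] at this
    exact (h2.getElem_inj_iff).1 this
  · have h5 := hS _ (h4 e he)
    have hlt' := hlt _ (hP e he)
    rwa [show (16 * vs.getD e.1 0 + vs.getD e.2 0) / 16 = vs.getD e.1 0 by omega,
      show (16 * vs.getD e.1 0 + vs.getD e.2 0) % 16 = vs.getD e.2 0 by omega] at h5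

/-- A complete case analysis refutes the coloring. -/
lemma CaseTree.false_of_check (hn : n ≤ 16) (hg : Set.InjOn g {v | v < n})
    (htot : ∀ u v, u ≠ v → Red.Adj u v ∨ Blue.Adj u v) {FR FB : List Pattern}
    (hFR : ∀ P ∈ FR, P.wellFormed n ∧ ¬ P.OccursIn Red)
    (hFB : ∀ P ∈ FB, P.wellFormed n ∧ ¬ P.OccursIn Blue) :
    ∀ {t : CaseTree} {R B : ℕ}, Represents g R Red → Represents g B Blue →
      t.check n FR FB R B → False
  | .split u v r b, R, B, hR, hB, h => by
    simp only [CaseTree.check, Bool.and_eq_true, Nat.blt_eq, Bool.not_eq_true'] at h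
    obtain ⟨⟨⟨⟨hu, hv⟩, huv⟩, hr⟩, hb⟩ := h
    have hne : g u ≠ g v := fun he => by
      rw [hg hu hv he, Nat.beq_refl] at huv
      cases huv
    rcases htot _ _ hne with h | h
    · exact false_of_check hn hg htot hFR hFB (hR.insertEdge (by omega) (by omega) h) hB hr
    · exact false_of_check hn hg htot hFR hFB hR (hB.insertEdge (by omega) (by omega) h) hb
  | .red k vs, R, B, hR, hB, h => by
    simp only [CaseTree.check] at h
    split at h
    · cases h
    · next P hP =>
      obtain ⟨hw, hP'⟩ := hFR P (List.mem_of_getElem? hP)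
      exact hP' (Pattern.occursIn_of_check hn
        (fun e he => (Pattern.edge_lt_of_wellFormed hw e he).2) hg hR h)
  | .blue k vs, R, B, hR, hB, h => by
    simp only [CaseTree.check] at h
    split at h
    · cases h
    · next P hP =>
      obtain ⟨hw, hP'⟩ := hFB P (List.mem_of_getElem? hP)
      exact hP' (Pattern.occursIn_of_check hn
        (fun e he => (Pattern.edge_lt_of_wellFormed hw e he).2) hg hB h)

/-- An injective labeling of the first `m` numbers by vertices extends to the first `n` numbers. -/
lemma exists_injOn_extension [Fintype V] {m : ℕ} (hmn : m ≤ n) (hn : n ≤ Fintype.card V)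
    {f : ℕ → V} (hf : Set.InjOn f {v | v < m}) :
    ∃ g : ℕ → V, Set.InjOn g {v | v < n} ∧ ∀ v < m, g v = f v := by
  classical
  induction n, hmn using Nat.le_induction with
  | base => exact ⟨f, hf, fun _ _ => rfl⟩
  | succ k hk ih =>
    obtain ⟨g, hg, hgf⟩ := ih (by omega)
    obtain ⟨x, hx⟩ : ∃ x, x ∉ (Finset.range k).image g := by
      by_contra! h
      have := Finset.card_le_card fun x (_ : x ∈ Finset.univ) => h x
      have := this.trans Finset.card_image_le
      rw [Finset.card_univ, Finset.card_range] at this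
      omega
    have hx' : ∀ v < k, g v ≠ x := fun v hv h =>
      hx (Finset.mem_image.2 ⟨v, Finset.mem_range.2 hv, h⟩)
    refine ⟨Function.update g k x, fun u hu v hv he => ?_, fun v hv => ?_⟩
    · simp only [Set.mem_ofPred_eq] at hu hv
      rcases Nat.lt_succ_iff_lt_or_eq.1 hu with h | rfl <;>
        rcases Nat.lt_succ_iff_lt_or_eq.1 hv with h' | rfl
      · rw [Function.update_of_ne (by omega), Function.update_of_ne (by omega)] at he
        exact hg h h' he
      · rw [Function.update_of_ne (by omega), Function.update_self] at he
        exact absurd he (hx' u h)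
      · rw [Function.update_self, Function.update_of_ne (by omega)] at he
        exact absurd he.symm (hx' v h')
      · rfl
    · rw [Function.update_of_ne (by omega), hgf v hv]

/-- A step of a chain of case analyses refutes its start pattern. -/
lemma not_occursIn_of_check [Fintype V] (hn : n ≤ 16) (hV : n ≤ Fintype.card V)
    (htot : ∀ u v, u ≠ v → Red.Adj u v ∨ Blue.Adj u v) {FR FB : List Pattern}
    (hFR : ∀ P ∈ FR, P.wellFormed n ∧ ¬ P.OccursIn Red)
    (hFB : ∀ P ∈ FB, P.wellFormed n ∧ ¬ P.OccursIn Blue) {P : Pattern} {t : CaseTree}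
    (hP : P.wellFormed n) (ht : t.check n FR FB (edgeMask P.edges) 0) : ¬ P.OccursIn Red := by
  rintro ⟨f, hf, hadj⟩
  obtain ⟨g, hg, hgf⟩ := exists_injOn_extension (Pattern.order_le_of_wellFormed hP) hV hf
  refine CaseTree.false_of_check hn hg htot hFR hFB ?_ represents_zero ht
  have hlt := Pattern.edge_lt_of_wellFormed hP
  have := Pattern.order_le_of_wellFormed hP
  refine represents_edgeMask (fun e he => ?_) fun e he => ?_
  · have := hlt e he
    omega
  · rw [hgf _ (hlt e he).1, hgf _ (hlt e he).2]
    exact hadj e he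

lemma not_occursIn_of_checkRed [Fintype V] (hn : n ≤ 16) (hV : n ≤ Fintype.card V)
    (htot : ∀ u v, u ≠ v → Red.Adj u v ∨ Blue.Adj u v) {FB : List Pattern}
    (hFB : ∀ P ∈ FB, P.wellFormed n ∧ ¬ P.OccursIn Blue) :
    ∀ {l : List (Pattern × CaseTree)} {FR : List Pattern},
      (∀ P ∈ FR, P.wellFormed n ∧ ¬ P.OccursIn Red) → checkRed n FR FB l →
      ∀ s ∈ l, ¬ s.1.OccursIn Red
  | [], _, _, _ => by simp
  | (P, t) :: l, FR, hFR, h => by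
    simp only [checkRed, Bool.and_eq_true] at h
    obtain ⟨⟨hP, ht⟩, hl⟩ := h
    have hP' := not_occursIn_of_check hn hV htot hFR hFB hP ht
    intro s hs
    rcases List.mem_cons.1 hs with rfl | hs
    · exact hP'
    · refine not_occursIn_of_checkRed hn hV htot hFB (fun Q hQ => ?_) hl s hs
      rcases List.mem_append.1 hQ with hQ | hQ
      · exact hFR Q hQ
      · obtain rfl := List.mem_singleton.1 hQ
        exact ⟨hP, hP'⟩

lemma not_occursIn_of_checkBoth [Fintype V] (hn : n ≤ 16) (hV : n ≤ Fintype.card V)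
    (htot : ∀ u v, u ≠ v → Red.Adj u v ∨ Blue.Adj u v) :
    ∀ {l : List (Pattern × CaseTree)} {F : List Pattern},
      (∀ P ∈ F, P.wellFormed n ∧ ¬ P.OccursIn Red ∧ ¬ P.OccursIn Blue) → checkBoth n F l →
      ∀ s ∈ l, ¬ s.1.OccursIn Red
  | [], _, _, _ => by simp
  | (P, t) :: l, F, hF, h => by
    simp only [checkBoth, Bool.and_eq_true] at h
    obtain ⟨⟨hP, ht⟩, hl⟩ := h
    have hR : ∀ P ∈ F, P.wellFormed n ∧ ¬ P.OccursIn Red := fun P h => ⟨(hF P h).1, (hF P h).2.1⟩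
    have hB : ∀ P ∈ F, P.wellFormed n ∧ ¬ P.OccursIn Blue := fun P h => ⟨(hF P h).1, (hF P h).2.2⟩
    have hPR := not_occursIn_of_check hn hV htot hR hB hP ht
    have hPB := not_occursIn_of_check hn hV (fun u v h => (htot u v h).symm) hB hR hP ht
    intro s hs
    rcases List.mem_cons.1 hs with rfl | hs
    · exact hPR
    · refine not_occursIn_of_checkBoth hn hV htot (fun Q hQ => ?_) hl s hs
      rcases List.mem_append.1 hQ with hQ | hQ
      · exact hF Q hQ
      · obtain rfl := List.mem_singleton.1 hQ
        exact ⟨hP, hPR, hPB⟩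

/-- The pattern without vertices, which occurs everywhere: it is the start of the last step of a
chain that refutes a coloring. -/
def Pattern.empty : Pattern := ⟨0, []⟩

lemma Pattern.empty_occursIn [Nonempty V] : Pattern.empty.OccursIn H := by
  obtain ⟨x⟩ := ‹Nonempty V›
  exact ⟨fun _ => x, fun v hv => absurd hv (Nat.not_lt_zero v), fun e he => by cases he⟩

/-- The pattern of the graph `targetGraph i`. -/
def targetPattern (i : Fin 4) : Pattern :=
  if i = 3 then Pattern.cycle 8 else Pattern.path (2 * i + 3)

lemma targetGraph_isContained_of_occursIn {i : Fin 4} (h : (targetPattern i).OccursIn H) :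
    targetGraph i ⊑ H := by
  have key : ∀ {m : ℕ} {f : ℕ → V}, Set.InjOn f {v | v < m} →
      (∀ e ∈ (Pattern.path m).edges, H.Adj (f e.1) (f e.2)) →
      ((List.range m).map f).Nodup ∧ ((List.range m).map f).IsChain H.Adj := by
    intro m f hf hadj
    refine ⟨List.Nodup.map_on (fun u hu v hv he => hf (by simpa using hu) (by simpa using hv) he)
      List.nodup_range, ?_⟩
    rw [List.isChain_iff_getElem]
    intro k hk
    simp only [List.length_map, List.length_range] at hk
    simp only [List.getElem_map, List.getElem_range]
    exact hadj (k, k + 1) (List.mem_map.2 ⟨k, List.mem_range.2 (by omega), rfl⟩)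
  by_cases hi : i = 3
  · subst hi
    obtain ⟨f, hf, hadj⟩ := h
    obtain ⟨h1, h2⟩ := key (m := 8) hf fun e he => hadj e (List.mem_cons_of_mem _ he)
    exact cycleGraph_eight_isContained h1 h2 (by simp) (hadj (7, 0) (by
      simp [targetPattern, Pattern.cycle]))
  · rw [targetPattern, if_neg hi] at h
    obtain ⟨f, hf, hadj⟩ := h
    obtain ⟨h1, h2⟩ := key hf hadj
    rw [targetGraph_isContained_iff_of_le_two (by omega), pathGraph_isContained_iff]
    exact ⟨_, h1, h2, by simp [Pattern.path]⟩

end Soundness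

/-- The case analysis for two colors without a cycle on eight vertices, on `11` vertices. -/
def cases33 : List (Pattern × CaseTree) := [
  (.cycleSeven 8 [(0, 7), (3, 7)],
    .split 1 7 (.red 0 [1, 7, 0, 6, 5, 4, 3, 2]) (.split 2 7 (.red 0 [2, 7, 3, 4, 5, 6, 0, 1])
    (.split 1 4 (.red 0 [1, 4, 5, 6, 0, 7, 3, 2]) (.split 4 7 (.red 0 [4, 7, 3, 2, 1, 0, 6, 5])
    (.split 6 7 (.red 0 [6, 7, 0, 1, 2, 3, 4, 5]) (.split 2 6 (.red 0 [2, 6, 5, 4, 3, 7, 0, 1])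
    (.split 2 8 (.split 7 8 (.red 0 [7, 8, 2, 3, 4, 5, 6, 0]) (.split 5 8
    (.red 0 [5, 8, 2, 1, 0, 7, 3, 4]) (.split 1 8 (.red 0 [1, 8, 2, 3, 4, 5, 6, 0]) (.split 3 8
    (.red 0 [3, 8, 2, 1, 0, 6, 5, 4]) (.split 4 8 (.red 0 [4, 8, 2, 3, 7, 0, 6, 5]) (.split 3 10
    (.split 2 10 (.red 0 [2, 10, 3, 4, 5, 6, 0, 1]) (.split 4 10
    (.red 0 [4, 10, 3, 2, 1, 0, 6, 5]) (.split 5 10 (.split 3 6 (.split 7 10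
    (.red 0 [7, 10, 5, 4, 3, 2, 1, 0]) (.split 2 5 (.split 8 10 (.red 0 [8, 10, 3, 7, 0, 6, 5, 2])
    (.split 1 10 (.red 0 [1, 10, 3, 7, 0, 6, 5, 2]) (.split 6 10
    (.red 0 [6, 10, 3, 4, 5, 2, 1, 0]) (.split 2 4 (.red 0 [2, 4, 3, 10, 5, 6, 0, 1]) (.split 5 7
    (.split 1 5 (.split 0 8 (.red 0 [0, 8, 2, 1, 5, 4, 3, 6]) (.split 1 3 (.split 0 4 (.split 1 6
    (.red 0 [1, 6, 0, 4, 3, 7, 5, 2]) (.split 6 9 (.split 0 9 (.red 0 [0, 9, 6, 3, 1, 2, 5, 4])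
    (.split 4 9 (.red 0 [4, 9, 6, 0, 1, 3, 2, 5]) (.blue 0 [4, 9, 0, 8, 1, 6, 2, 7]))) (.split 0 9
    (.split 2 9 (.red 0 [2, 9, 0, 4, 3, 6, 5, 1]) (.blue 0 [2, 9, 6, 1, 4, 7, 8, 10]))
    (.blue 0 [0, 9, 6, 1, 4, 2, 7, 8])))) (.blue 0 [0, 4, 1, 7, 2, 6, 10, 8]))
    (.blue 0 [1, 3, 8, 4, 2, 6, 7, 10]))) (.blue 0 [1, 5, 8, 4, 2, 6, 7, 10]))
    (.blue 0 [5, 7, 1, 4, 2, 6, 10, 8])))))) (.blue 0 [2, 5, 8, 1, 4, 10, 7, 6])))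
    (.blue 0 [3, 6, 2, 10, 4, 1, 7, 8])) (.blue 0 [5, 10, 2, 6, 7, 1, 4, 8])))) (.split 6 10
    (.split 0 10 (.red 0 [0, 10, 6, 5, 4, 3, 2, 1]) (.split 0 2 (.split 2 10
    (.red 0 [2, 10, 6, 5, 4, 3, 7, 0]) (.blue 0 [2, 10, 3, 8, 1, 4, 7, 6]))
    (.blue 0 [0, 2, 6, 7, 1, 8, 3, 10]))) (.blue 0 [6, 10, 3, 8, 1, 4, 7, 2])))))))) (.split 2 4
    (.split 5 7 (.red 0 [5, 7, 3, 4, 2, 1, 0, 6]) (.split 1 5 (.red 0 [1, 5, 6, 0, 7, 3, 4, 2])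
    (.split 1 3 (.red 0 [1, 3, 7, 0, 6, 5, 4, 2]) (.split 3 6 (.red 0 [3, 6, 5, 4, 2, 1, 0, 7])
    (.split 4 8 (.split 5 8 (.red 0 [5, 8, 4, 2, 3, 7, 0, 6]) (.blue 0 [5, 8, 2, 6, 3, 1, 4, 7]))
    (.blue 0 [4, 8, 2, 6, 3, 1, 5, 7])))))) (.split 7 10 (.split 2 10
    (.red 0 [2, 10, 7, 0, 6, 5, 4, 3]) (.split 5 10 (.red 0 [5, 10, 7, 0, 1, 2, 3, 4])
    (.split 1 10 (.red 0 [1, 10, 7, 3, 4, 5, 6, 0]) (.split 5 8 (.split 7 8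
    (.red 0 [7, 8, 5, 4, 3, 2, 1, 0]) (.split 6 8 (.red 0 [6, 8, 5, 4, 3, 2, 1, 0]) (.split 1 5
    (.split 0 10 (.red 0 [0, 10, 7, 3, 2, 1, 5, 6]) (.split 3 10
    (.red 0 [3, 10, 7, 0, 6, 5, 1, 2]) (.split 3 6 (.split 1 3 (.split 4 6
    (.red 0 [4, 6, 0, 7, 3, 2, 1, 5]) (.split 6 10 (.red 0 [6, 10, 7, 0, 1, 3, 4, 5]) (.split 2 5
    (.split 0 4 (.split 8 10 (.red 0 [8, 10, 7, 0, 1, 3, 2, 5]) (.split 3 8 (.split 0 2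
    (.split 1 6 (.red 0 [1, 6, 0, 4, 3, 8, 5, 2]) (.split 4 9 (.split 6 9
    (.red 0 [6, 9, 4, 0, 1, 3, 2, 5]) (.split 3 9 (.red 0 [3, 9, 4, 0, 1, 2, 5, 6])
    (.blue 0 [3, 9, 6, 1, 4, 2, 8, 10]))) (.split 3 9 (.split 8 9
    (.red 0 [8, 9, 3, 1, 2, 0, 4, 5]) (.blue 0 [8, 9, 4, 1, 6, 7, 2, 10]))
    (.blue 0 [3, 9, 4, 1, 6, 2, 8, 10])))) (.blue 0 [0, 2, 4, 1, 7, 6, 8, 10]))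
    (.blue 0 [3, 8, 2, 4, 1, 7, 6, 10]))) (.blue 0 [0, 4, 1, 7, 2, 8, 6, 10]))
    (.blue 0 [2, 5, 10, 1, 4, 6, 7, 8])))) (.blue 0 [1, 3, 10, 2, 6, 8, 7, 4]))
    (.blue 0 [3, 6, 2, 8, 7, 4, 1, 10])))) (.blue 0 [1, 5, 10, 2, 6, 8, 7, 4]))))
    (.blue 0 [5, 8, 2, 6, 7, 4, 1, 10]))))) (.split 6 9 (.split 0 9
    (.red 0 [0, 9, 6, 5, 4, 3, 2, 1]) (.split 1 9 (.red 0 [1, 9, 6, 5, 4, 3, 7, 0]) (.split 0 10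
    (.split 9 10 (.red 0 [9, 10, 0, 7, 3, 4, 5, 6]) (.split 6 8 (.split 8 10
    (.red 0 [8, 10, 0, 7, 3, 4, 5, 6]) (.blue 0 [8, 10, 9, 1, 4, 7, 6, 2]))
    (.blue 0 [6, 8, 2, 4, 1, 9, 10, 7]))) (.blue 0 [0, 10, 7, 6, 2, 4, 1, 9])))) (.split 5 8
    (.split 4 8 (.red 0 [4, 8, 5, 6, 0, 1, 2, 3]) (.split 6 8 (.red 0 [6, 8, 5, 4, 3, 2, 1, 0])
    (.split 9 10 (.split 1 8 (.red 0 [1, 8, 5, 6, 0, 7, 3, 2]) (.split 7 9 (.split 6 10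
    (.red 0 [6, 10, 9, 7, 3, 2, 1, 0]) (.split 2 9 (.red 0 [2, 9, 7, 0, 6, 5, 4, 3])
    (.blue 0 [2, 9, 6, 10, 7, 1, 4, 8]))) (.split 1 10 (.split 8 10
    (.red 0 [8, 10, 1, 0, 7, 3, 4, 5]) (.blue 0 [8, 10, 7, 9, 6, 2, 4, 1]))
    (.blue 0 [1, 10, 7, 9, 6, 2, 4, 8])))) (.blue 0 [9, 10, 7, 1, 4, 2, 8, 6])))) (.split 5 9
    (.split 4 9 (.red 0 [4, 9, 5, 6, 0, 1, 2, 3]) (.split 8 10 (.split 1 9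
    (.red 0 [1, 9, 5, 6, 0, 7, 3, 2]) (.split 2 9 (.red 0 [2, 9, 5, 4, 3, 7, 0, 1]) (.split 5 10
    (.split 6 10 (.red 0 [6, 10, 5, 4, 3, 2, 1, 0]) (.split 6 8 (.red 0 [6, 8, 10, 5, 4, 3, 7, 0])
    (.blue 0 [6, 8, 2, 4, 9, 1, 7, 10]))) (.blue 0 [5, 10, 7, 1, 4, 9, 2, 8]))))
    (.blue 0 [8, 10, 7, 1, 4, 9, 6, 2]))) (.blue 0 [5, 9, 6, 7, 1, 4, 2, 8]))))))))))))),
  (.cycleSeven 8 [(0, 7), (2, 7)],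
    .split 6 7 (.red 0 [6, 7, 0, 1, 2, 3, 4, 5]) (.split 1 6 (.red 0 [1, 6, 5, 4, 3, 2, 7, 0])
    (.split 3 7 (.red 0 [3, 7, 2, 1, 0, 6, 5, 4]) (.split 5 7 (.red 1 [5, 4, 3, 2, 1, 0, 6, 7])
    (.split 1 5 (.red 1 [5, 4, 3, 2, 7, 0, 6, 1]) (.split 1 3 (.red 0 [1, 3, 4, 5, 6, 0, 7, 2])
    (.split 4 7 (.red 1 [4, 5, 6, 0, 1, 2, 3, 7]) (.split 1 4 (.red 1 [4, 5, 6, 0, 7, 2, 3, 1])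
    (.split 7 9 (.split 5 9 (.red 0 [5, 9, 7, 0, 1, 2, 3, 4]) (.split 0 9
    (.red 0 [0, 9, 7, 2, 3, 4, 5, 6]) (.split 2 9 (.red 0 [2, 9, 7, 0, 6, 5, 4, 3]) (.split 4 9
    (.red 0 [4, 9, 7, 2, 1, 0, 6, 5]) (.split 2 6 (.split 0 3 (.split 3 9
    (.red 1 [6, 5, 4, 3, 9, 7, 2, 0]) (.split 2 5 (.split 7 10 (.split 3 10
    (.red 0 [3, 10, 7, 0, 1, 2, 5, 4]) (.split 0 10 (.red 0 [0, 10, 7, 2, 3, 4, 5, 6])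
    (.blue 0 [0, 10, 3, 1, 4, 7, 5, 9]))) (.split 0 10 (.split 6 10
    (.red 0 [6, 10, 0, 1, 2, 3, 4, 5]) (.blue 1 [1, 6, 10, 7, 4, 9, 5, 3]))
    (.blue 1 [9, 0, 10, 7, 4, 1, 5, 3]))) (.blue 1 [9, 2, 5, 1, 6, 7, 4, 3])))
    (.blue 1 [9, 0, 3, 1, 6, 7, 5, 4])) (.blue 1 [9, 2, 6, 1, 3, 7, 5, 4])))))) (.split 3 8
    (.split 6 8 (.red 1 [6, 5, 4, 3, 2, 1, 0, 8]) (.split 2 8 (.red 0 [2, 8, 3, 4, 5, 6, 0, 1])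
    (.split 4 8 (.red 0 [4, 8, 3, 2, 1, 0, 6, 5]) (.split 2 9 (.split 5 9
    (.red 1 [5, 4, 3, 2, 1, 0, 6, 9]) (.blue 1 [1, 5, 9, 7, 4, 8, 6, 3]))
    (.blue 1 [8, 2, 9, 7, 3, 1, 6, 4]))))) (.split 4 8 (.split 5 8
    (.red 0 [5, 8, 4, 3, 2, 1, 0, 6]) (.split 4 9 (.split 0 8 (.red 1 [0, 6, 5, 4, 3, 2, 1, 8])
    (.split 0 9 (.red 1 [0, 6, 5, 4, 3, 2, 1, 9]) (.blue 1 [8, 0, 9, 7, 4, 1, 5, 3])))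
    (.blue 1 [1, 4, 9, 7, 3, 8, 5, 6]))) (.split 5 9 (.split 6 9 (.red 0 [6, 9, 5, 4, 3, 2, 1, 0])
    (.blue 1 [1, 6, 9, 7, 3, 8, 4, 5])) (.blue 1 [1, 5, 9, 7, 3, 8, 4, 6]))))))))))))),
  (.cycleSeven 9 [(0, 7), (7, 8)],
    .split 5 7 (.red 2 [5, 7, 0, 1, 2, 3, 4, 6]) (.split 1 7 (.red 0 [1, 7, 0, 6, 5, 4, 3, 2])
    (.split 2 8 (.red 0 [2, 8, 7, 0, 6, 5, 4, 3]) (.split 6 7 (.red 0 [6, 7, 0, 1, 2, 3, 4, 5])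
    (.split 4 7 (.red 1 [4, 5, 6, 0, 1, 2, 3, 7]) (.split 2 7 (.red 2 [2, 7, 0, 6, 5, 4, 3, 1])
    (.split 5 8 (.red 0 [5, 8, 7, 0, 1, 2, 3, 4]) (.split 3 7 (.red 1 [3, 2, 1, 0, 6, 5, 4, 7])
    (.split 3 8 (.split 4 8 (.red 0 [4, 8, 3, 2, 1, 0, 6, 5]) (.split 2 5
    (.red 0 [2, 5, 4, 3, 8, 7, 0, 1]) (.split 1 8 (.red 2 [1, 8, 3, 4, 5, 6, 0, 2]) (.split 1 3
    (.red 1 [3, 8, 7, 0, 6, 5, 4, 1]) (.split 2 6 (.red 1 [6, 5, 4, 3, 8, 7, 0, 2])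
    (.blue 1 [8, 1, 3, 7, 6, 2, 5, 4])))))) (.split 6 8 (.split 1 3
    (.red 0 [1, 3, 4, 5, 6, 8, 7, 0]) (.split 4 6 (.red 0 [4, 6, 8, 7, 0, 1, 2, 3]) (.split 2 4
    (.red 0 [2, 4, 5, 6, 8, 7, 0, 1]) (.blue 1 [7, 1, 3, 8, 2, 4, 6, 5])))) (.split 4 8
    (.split 1 5 (.red 1 [1, 2, 3, 4, 8, 7, 0, 5]) (.split 2 6 (.red 0 [2, 6, 5, 4, 8, 7, 0, 1])
    (.split 4 6 (.red 1 [4, 8, 7, 0, 1, 2, 3, 6]) (.blue 1 [8, 5, 1, 7, 4, 6, 2, 3]))))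
    (.split 1 8 (.split 3 5 (.red 0 [3, 5, 6, 0, 7, 8, 1, 2]) (.split 4 6
    (.red 0 [4, 6, 0, 7, 8, 1, 2, 3]) (.split 1 3 (.red 0 [1, 3, 4, 5, 6, 0, 7, 8])
    (.blue 1 [8, 6, 4, 7, 1, 3, 5, 2])))) (.split 2 9 (.split 6 9
    (.red 1 [6, 0, 1, 2, 3, 4, 5, 9]) (.split 3 9 (.red 0 [3, 9, 2, 1, 0, 6, 5, 4]) (.split 5 9
    (.red 1 [5, 4, 3, 2, 1, 0, 6, 9]) (.split 3 5 (.split 4 9 (.red 0 [4, 9, 2, 1, 0, 6, 5, 3])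
    (.split 1 3 (.split 1 9 (.red 0 [1, 9, 2, 3, 4, 5, 6, 0]) (.split 1 4 (.split 0 9
    (.red 0 [0, 9, 2, 1, 3, 4, 5, 6]) (.split 0 2 (.split 8 10 (.split 1 10
    (.red 0 [1, 10, 8, 7, 0, 2, 3, 4]) (.split 4 10 (.red 0 [4, 10, 8, 7, 0, 1, 2, 3])
    (.blue 0 [4, 10, 1, 7, 2, 8, 3, 9]))) (.split 4 10 (.split 0 10
    (.red 0 [0, 10, 4, 1, 2, 3, 5, 6]) (.blue 1 [9, 0, 10, 8, 2, 7, 3, 1]))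
    (.blue 1 [7, 4, 10, 8, 3, 9, 5, 1]))) (.blue 1 [9, 0, 2, 7, 3, 8, 4, 1])))
    (.blue 1 [7, 1, 4, 8, 3, 9, 5, 2]))) (.blue 1 [7, 1, 3, 8, 4, 9, 5, 2])))
    (.blue 2 [8, 1, 7, 3, 5, 9, 6, 2]))))) (.split 1 9 (.split 3 9
    (.red 2 [3, 9, 1, 0, 6, 5, 4, 2]) (.split 4 9 (.red 1 [4, 3, 2, 1, 0, 6, 5, 9]) (.split 6 9
    (.red 2 [6, 9, 1, 2, 3, 4, 5, 0]) (.split 3 6 (.split 1 3 (.split 5 9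
    (.red 1 [3, 6, 0, 1, 9, 5, 4, 2]) (.split 2 6 (.split 2 4 (.split 0 9
    (.red 0 [0, 9, 1, 2, 3, 4, 5, 6]) (.split 8 10 (.split 3 10 (.red 0 [3, 10, 8, 7, 0, 1, 2, 4])
    (.split 6 10 (.red 0 [6, 10, 8, 7, 0, 1, 2, 3]) (.blue 0 [6, 10, 3, 7, 1, 8, 2, 9])))
    (.split 0 10 (.split 2 10 (.red 0 [2, 10, 0, 1, 3, 4, 5, 6])
    (.blue 1 [7, 2, 10, 8, 3, 9, 4, 1])) (.blue 1 [9, 0, 10, 8, 1, 7, 3, 2]))))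
    (.blue 1 [7, 2, 4, 8, 3, 9, 5, 1])) (.blue 1 [7, 2, 6, 8, 3, 9, 4, 1])))
    (.blue 1 [7, 1, 3, 8, 4, 9, 6, 2])) (.blue 1 [7, 3, 6, 8, 2, 9, 4, 1]))))) (.split 3 6
    (.split 1 3 (.split 2 4 (.split 2 10 (.split 1 10 (.red 0 [1, 10, 2, 3, 4, 5, 6, 0])
    (.split 8 10 (.red 0 [8, 10, 2, 1, 3, 6, 0, 7]) (.blue 2 [7, 3, 8, 10, 1, 9, 2, 4])))
    (.split 8 10 (.split 3 10 (.red 0 [3, 10, 8, 7, 0, 1, 2, 4])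
    (.blue 0 [3, 10, 2, 9, 1, 7, 4, 8])) (.blue 2 [7, 3, 8, 10, 2, 9, 1, 4])))
    (.blue 2 [8, 3, 7, 4, 2, 9, 1, 5])) (.blue 2 [8, 4, 7, 3, 1, 9, 2, 5]))
    (.blue 1 [7, 3, 6, 8, 1, 9, 2, 4])))))))))))))))),
  (.cycleSeven 9 [(0, 7), (2, 8)],
    .split 4 7 (.red 1 [4, 5, 6, 0, 1, 2, 3, 7]) (.split 1 8 (.red 0 [1, 8, 2, 3, 4, 5, 6, 0])
    (.split 8 9 (.red 3 [2, 1, 0, 6, 5, 4, 3, 8, 9]) (.split 3 8 (.red 0 [3, 8, 2, 1, 0, 6, 5, 4])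
    (.split 4 8 (.red 2 [4, 8, 2, 1, 0, 6, 5, 3]) (.split 0 8 (.red 2 [0, 8, 2, 3, 4, 5, 6, 1])
    (.split 1 7 (.red 0 [1, 7, 0, 6, 5, 4, 3, 2]) (.split 3 7 (.red 1 [3, 2, 1, 0, 6, 5, 4, 7])
    (.split 7 9 (.red 3 [0, 1, 2, 3, 4, 5, 6, 7, 9]) (.split 2 7 (.red 2 [2, 7, 0, 6, 5, 4, 3, 1])
    (.split 2 10 (.split 0 10 (.red 2 [0, 10, 2, 3, 4, 5, 6, 1]) (.split 1 10
    (.red 0 [1, 10, 2, 3, 4, 5, 6, 0]) (.split 2 9 (.split 1 9 (.red 0 [1, 9, 2, 3, 4, 5, 6, 0])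
    (.blue 2 [8, 3, 7, 9, 1, 10, 0, 4])) (.blue 1 [7, 2, 9, 8, 0, 10, 1, 3])))) (.split 4 9
    (.split 9 10 (.red 3 [4, 3, 2, 1, 0, 6, 5, 9, 10]) (.split 1 9
    (.red 1 [1, 2, 3, 4, 5, 6, 0, 9]) (.blue 2 [7, 3, 8, 1, 9, 10, 2, 4]))) (.split 1 10
    (.split 9 10 (.red 3 [1, 0, 6, 5, 4, 3, 2, 10, 9]) (.blue 2 [7, 1, 8, 4, 9, 10, 2, 3]))
    (.blue 1 [7, 9, 4, 8, 1, 10, 2, 3])))))))))))))),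
  (.cycleSeven 9 [(0, 7), (1, 8)],
    .split 4 7 (.red 1 [4, 5, 6, 0, 1, 2, 3, 7]) (.split 5 10
    (.red 4 [5, 6, 0, 1, 2, 3, 4, 10, 7]) (.split 5 8 (.red 1 [5, 6, 0, 1, 2, 3, 4, 8])
    (.split 3 7 (.red 1 [3, 2, 1, 0, 6, 5, 4, 7]) (.split 2 9 (.red 4 [2, 1, 0, 6, 5, 4, 3, 9, 7])
    (.split 2 10 (.red 4 [2, 1, 0, 6, 5, 4, 3, 10, 7]) (.split 3 9
    (.red 4 [3, 2, 1, 0, 6, 5, 4, 9, 8]) (.split 4 8 (.red 1 [4, 3, 2, 1, 0, 6, 5, 8])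
    (.blue 0 [4, 8, 5, 10, 2, 9, 3, 7]))))))))),
  (.cycleSeven 9 [(0, 7), (3, 8)],
    .split 4 9 (.red 5 [4, 3, 2, 1, 0, 6, 5, 9, 8]) (.split 4 10
    (.red 5 [4, 3, 2, 1, 0, 6, 5, 10, 8]) (.split 6 8 (.red 1 [6, 5, 4, 3, 2, 1, 0, 8])
    (.split 1 8 (.red 2 [1, 8, 3, 4, 5, 6, 0, 2]) (.split 6 10
    (.red 5 [6, 0, 1, 2, 3, 4, 5, 10, 7]) (.split 5 7 (.red 2 [5, 7, 0, 1, 2, 3, 4, 6])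
    (.split 5 9 (.red 4 [5, 4, 3, 2, 1, 0, 6, 9, 8]) (.split 1 7 (.red 0 [1, 7, 0, 6, 5, 4, 3, 2])
    (.blue 0 [1, 7, 5, 9, 4, 10, 6, 8]))))))))),
  (.cycleSeven 8 [(0, 7)],
    .split 4 9 (.red 6 [4, 5, 6, 0, 1, 2, 3, 9, 7]) (.split 3 10
    (.red 6 [3, 2, 1, 0, 6, 5, 4, 10, 7]) (.split 2 7 (.red 2 [2, 7, 0, 6, 5, 4, 3, 1])
    (.split 5 10 (.red 4 [5, 6, 0, 1, 2, 3, 4, 10, 7]) (.split 3 7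
    (.red 1 [3, 2, 1, 0, 6, 5, 4, 7]) (.split 2 9 (.red 4 [2, 1, 0, 6, 5, 4, 3, 9, 7]) (.split 5 8
    (.red 4 [5, 6, 0, 1, 2, 3, 4, 8, 7]) (.split 4 8 (.red 6 [4, 5, 6, 0, 1, 2, 3, 8, 7])
    (.blue 0 [4, 8, 5, 10, 3, 7, 2, 9]))))))))),
  (.cycle 7,
    .split 3 9 (.red 7 [3, 2, 1, 0, 6, 5, 4, 9]) (.split 2 8 (.red 7 [2, 1, 0, 6, 5, 4, 3, 8])
    (.split 4 7 (.red 7 [4, 3, 2, 1, 0, 6, 5, 7]) (.split 4 9 (.red 7 [4, 3, 2, 1, 0, 6, 5, 9])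
    (.split 2 7 (.red 7 [2, 1, 0, 6, 5, 4, 3, 7]) (.split 0 8 (.red 7 [0, 1, 2, 3, 4, 5, 6, 8])
    (.split 0 10 (.red 7 [0, 1, 2, 3, 4, 5, 6, 10]) (.split 3 10
    (.red 7 [3, 2, 1, 0, 6, 5, 4, 10]) (.blue 0 [3, 10, 0, 8, 2, 7, 4, 9]))))))))),
  (.path 9,
    .split 2 8 (.red 3 [2, 8, 7, 6, 5, 4, 3, 1, 0]) (.split 1 7
    (.red 5 [1, 7, 6, 5, 4, 3, 2, 0, 8]) (.split 0 6 (.red 3 [6, 0, 1, 2, 3, 4, 5, 7, 8])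
    (.split 1 8 (.red 0 [1, 8, 7, 6, 5, 4, 3, 2]) (.split 0 7 (.red 0 [0, 7, 6, 5, 4, 3, 2, 1])
    (.split 8 10 (.split 3 10 (.red 3 [3, 10, 8, 7, 6, 5, 4, 2, 1]) (.split 2 10
    (.red 0 [2, 10, 8, 7, 6, 5, 4, 3]) (.split 0 3 (.split 6 10 (.split 0 8
    (.red 2 [6, 7, 8, 0, 3, 4, 5, 10]) (.split 3 7 (.red 3 [3, 7, 8, 10, 6, 5, 4, 0, 1])
    (.split 2 6 (.red 3 [6, 2, 1, 0, 3, 4, 5, 7, 8]) (.blue 0 [2, 6, 0, 8, 1, 7, 3, 10]))))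
    (.blue 7 [10, 6, 0, 7, 1, 8, 2, 3])) (.blue 7 [0, 3, 10, 2, 8, 1, 7, 6])))) (.split 1 10
    (.split 7 10 (.red 0 [7, 10, 1, 2, 3, 4, 5, 6]) (.split 6 10
    (.red 3 [6, 10, 1, 2, 3, 4, 5, 7, 8]) (.split 2 10 (.split 0 5
    (.red 3 [5, 0, 1, 10, 2, 3, 4, 6, 7]) (.split 0 2 (.split 5 10
    (.red 3 [5, 10, 1, 0, 2, 3, 4, 6, 7]) (.split 5 8 (.split 2 6
    (.red 3 [2, 6, 7, 8, 5, 4, 3, 0, 1]) (.blue 0 [2, 6, 0, 5, 10, 7, 1, 8]))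
    (.blue 7 [8, 5, 0, 6, 10, 7, 1, 2]))) (.blue 7 [0, 2, 8, 1, 7, 10, 6, 5])))
    (.blue 8 [2, 10, 6, 0, 7, 1, 8])))) (.split 2 6 (.split 0 3
    (.red 3 [6, 2, 1, 0, 3, 4, 5, 7, 8]) (.split 5 8 (.red 3 [2, 3, 4, 5, 8, 7, 6, 1, 0])
    (.split 3 5 (.split 4 8 (.red 3 [2, 3, 5, 4, 8, 7, 6, 1, 0]) (.split 4 6 (.split 0 5
    (.red 3 [6, 5, 0, 1, 2, 3, 4, 7, 8]) (.split 2 10 (.split 4 10 (.split 3 7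
    (.red 3 [2, 3, 7, 6, 5, 4, 10, 1, 0]) (.blue 4 [8, 5, 0, 3, 7, 1, 10, 2, 6]))
    (.blue 4 [0, 5, 8, 4, 10, 1, 7, 3, 2])) (.blue 4 [0, 5, 8, 2, 10, 1, 7, 3, 4])))
    (.blue 6 [8, 4, 6, 0, 7, 1, 10, 2, 3]))) (.blue 6 [0, 3, 5, 8, 10, 1, 7, 6, 2]))))
    (.blue 8 [2, 6, 0, 7, 1, 10, 8]))))))))),
  (.path 8,
    .split 0 6 (.red 7 [6, 0, 1, 2, 3, 4, 5, 7]) (.split 0 10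
    (.red 9 [10, 0, 1, 2, 3, 4, 5, 6, 7]) (.split 7 9 (.red 9 [9, 7, 6, 5, 4, 3, 2, 1, 0])
    (.split 1 7 (.red 7 [1, 7, 6, 5, 4, 3, 2, 0]) (.split 0 9 (.red 9 [9, 0, 1, 2, 3, 4, 5, 6, 7])
    (.split 7 10 (.red 9 [10, 7, 6, 5, 4, 3, 2, 1, 0]) (.split 2 8 (.split 1 8
    (.red 9 [0, 1, 8, 2, 3, 4, 5, 6, 7]) (.split 3 8 (.red 9 [0, 1, 2, 8, 3, 4, 5, 6, 7])
    (.split 0 3 (.red 9 [8, 2, 1, 0, 3, 4, 5, 6, 7]) (.split 1 9 (.split 3 9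
    (.red 9 [8, 2, 1, 9, 3, 4, 5, 6, 7]) (.blue 7 [0, 9, 3, 8, 1, 7, 10, 6]))
    (.blue 7 [0, 3, 8, 1, 9, 7, 10, 6]))))) (.split 6 8 (.split 5 8
    (.red 9 [7, 6, 8, 5, 4, 3, 2, 1, 0]) (.split 5 7 (.red 9 [8, 6, 7, 5, 4, 3, 2, 1, 0])
    (.split 2 10 (.split 1 8 (.red 4 [1, 8, 6, 5, 4, 3, 2, 0, 7]) (.split 1 10
    (.red 9 [0, 1, 10, 2, 3, 4, 5, 6, 7]) (.blue 6 [8, 1, 10, 0, 9, 7, 5, 2, 6])))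
    (.blue 4 [7, 9, 0, 10, 2, 8, 5, 1, 6])))) (.split 2 9 (.split 3 9
    (.red 9 [0, 1, 2, 9, 3, 4, 5, 6, 7]) (.split 1 9 (.red 9 [0, 1, 9, 2, 3, 4, 5, 6, 7])
    (.blue 9 [3, 9, 1, 7, 10, 0, 6, 8, 2]))) (.blue 7 [7, 9, 2, 8, 6, 0, 10, 1])))))))))),
  (.path 7,
    .split 6 9 (.red 10 [9, 6, 5, 4, 3, 2, 1, 0]) (.split 6 8 (.red 10 [8, 6, 5, 4, 3, 2, 1, 0])
    (.split 0 9 (.red 10 [9, 0, 1, 2, 3, 4, 5, 6]) (.split 0 8 (.red 10 [8, 0, 1, 2, 3, 4, 5, 6])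
    (.split 0 7 (.red 10 [7, 0, 1, 2, 3, 4, 5, 6]) (.split 6 7 (.red 10 [7, 6, 5, 4, 3, 2, 1, 0])
    (.split 4 10 (.split 3 10 (.red 10 [0, 1, 2, 3, 10, 4, 5, 6]) (.split 5 10
    (.red 10 [6, 5, 10, 4, 3, 2, 1, 0]) (.split 3 9 (.split 5 9
    (.red 10 [10, 4, 5, 9, 3, 2, 1, 0]) (.blue 10 [3, 10, 5, 9, 0, 7, 6, 8]))
    (.blue 10 [5, 10, 3, 9, 0, 7, 6, 8])))) (.split 8 10 (.split 1 10
    (.red 10 [8, 10, 1, 2, 3, 4, 5, 6]) (.split 1 8 (.red 10 [10, 8, 1, 2, 3, 4, 5, 6])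
    (.blue 10 [4, 10, 1, 8, 0, 7, 6, 9]))) (.split 5 9 (.split 4 9
    (.red 10 [6, 5, 9, 4, 3, 2, 1, 0]) (.blue 8 [4, 9, 0, 7, 6, 8, 10]))
    (.blue 10 [5, 9, 0, 7, 6, 8, 10, 4])))))))))),
  (.path 6,
    .split 0 6 (.red 11 [6, 0, 1, 2, 3, 4, 5]) (.split 5 6 (.red 11 [6, 5, 4, 3, 2, 1, 0])
    (.split 5 8 (.red 11 [8, 5, 4, 3, 2, 1, 0]) (.split 0 10 (.red 11 [10, 0, 1, 2, 3, 4, 5])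
    (.split 7 10 (.split 4 10 (.red 11 [7, 10, 4, 3, 2, 1, 0]) (.split 4 7
    (.red 11 [10, 7, 4, 3, 2, 1, 0]) (.blue 11 [7, 4, 10, 0, 6, 5, 8]))) (.split 3 7 (.split 2 7
    (.red 11 [0, 1, 2, 7, 3, 4, 5]) (.blue 11 [2, 7, 10, 0, 6, 5, 8]))
    (.blue 11 [3, 7, 10, 0, 6, 5, 8]))))))),
  (.path 5,
    .split 0 5 (.red 12 [5, 0, 1, 2, 3, 4]) (.split 0 9 (.red 12 [9, 0, 1, 2, 3, 4]) (.split 4 5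
    (.red 12 [5, 4, 3, 2, 1, 0]) (.split 4 8 (.red 12 [8, 4, 3, 2, 1, 0]) (.split 6 9 (.split 1 9
    (.red 12 [6, 9, 1, 2, 3, 4]) (.blue 12 [1, 9, 0, 5, 4, 8])) (.blue 12 [6, 9, 0, 5, 4, 8])))))),
  (.path 4,
    .split 3 7 (.red 13 [7, 3, 2, 1, 0]) (.split 0 6 (.red 13 [6, 0, 1, 2, 3]) (.split 0 7
    (.red 13 [7, 0, 1, 2, 3]) (.split 3 9 (.red 13 [9, 3, 2, 1, 0]) (.blue 13 [9, 3, 7, 0, 6]))))),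
  (.path 3,
    .split 0 8 (.red 14 [8, 0, 1, 2]) (.split 2 9 (.red 14 [9, 2, 1, 0]) (.split 0 9
    (.red 14 [9, 0, 1, 2]) (.blue 14 [8, 0, 9, 2])))),
  (.path 2,
    .split 0 3 (.red 15 [3, 0, 1]) (.split 0 7 (.red 15 [7, 0, 1]) (.blue 15 [7, 0, 3]))),
  (.empty,
    .split 1 2 (.red 16 [1, 2]) (.blue 16 [1, 2]))]

/-- The case analysis for red without `P₅` and blue without `C₈`, on `9` vertices. -/
def cases13 : List (Pattern × CaseTree) := [
  (.path 4,
    .split 3 7 (.red 0 [7, 3, 2, 1, 0]) (.split 0 6 (.red 0 [6, 0, 1, 2, 3]) (.split 3 8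
    (.red 0 [8, 3, 2, 1, 0]) (.split 0 8 (.red 0 [8, 0, 1, 2, 3]) (.split 0 7
    (.red 0 [7, 0, 1, 2, 3]) (.split 3 4 (.red 0 [4, 3, 2, 1, 0]) (.split 3 5
    (.red 0 [5, 3, 2, 1, 0]) (.split 0 5 (.red 0 [5, 0, 1, 2, 3]) (.split 4 8 (.split 2 4
    (.red 0 [8, 4, 2, 1, 0]) (.split 1 4 (.red 0 [8, 4, 1, 2, 3]) (.split 1 8
    (.red 0 [4, 8, 1, 2, 3]) (.split 2 8 (.red 0 [4, 8, 2, 1, 0]) (.split 1 7 (.split 2 7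
    (.red 0 [3, 2, 7, 1, 0]) (.blue 0 [2, 7, 0, 5, 3, 4, 1, 8]))
    (.blue 0 [1, 7, 0, 5, 3, 4, 2, 8])))))) (.split 4 6 (.split 2 6 (.red 0 [4, 6, 2, 1, 0])
    (.split 1 4 (.red 0 [6, 4, 1, 2, 3]) (.split 1 6 (.red 0 [4, 6, 1, 2, 3]) (.split 2 5
    (.split 5 7 (.red 0 [7, 5, 2, 1, 0]) (.blue 0 [5, 7, 0, 6, 1, 4, 8, 3]))
    (.blue 0 [2, 5, 0, 7, 3, 4, 1, 6]))))) (.split 2 7 (.split 6 7 (.red 0 [6, 7, 2, 1, 0])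
    (.split 1 7 (.red 0 [0, 1, 7, 2, 3]) (.split 1 3 (.red 0 [0, 1, 3, 2, 7])
    (.blue 0 [1, 3, 5, 0, 8, 4, 6, 7])))) (.split 2 5 (.split 1 3 (.red 0 [0, 1, 3, 2, 5])
    (.split 5 8 (.red 0 [8, 5, 2, 1, 0]) (.split 1 5 (.red 0 [0, 1, 5, 2, 3])
    (.blue 0 [1, 5, 8, 4, 6, 0, 7, 3])))) (.blue 0 [2, 5, 0, 6, 4, 8, 3, 7]))))))))))))),
  (.path 3,
    .split 0 3 (.red 1 [3, 0, 1, 2]) (.split 0 5 (.red 1 [5, 0, 1, 2]) (.split 2 7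
    (.red 1 [7, 2, 1, 0]) (.split 2 6 (.red 1 [6, 2, 1, 0]) (.split 0 8 (.red 1 [8, 0, 1, 2])
    (.split 2 3 (.red 1 [3, 2, 1, 0]) (.split 2 5 (.red 1 [5, 2, 1, 0]) (.split 0 4
    (.red 1 [4, 0, 1, 2]) (.split 0 7 (.red 1 [7, 0, 1, 2]) (.split 2 4 (.red 1 [4, 2, 1, 0])
    (.split 2 8 (.red 1 [8, 2, 1, 0]) (.split 1 5 (.split 3 5 (.red 1 [3, 5, 1, 0]) (.split 5 8
    (.red 1 [8, 5, 1, 0]) (.split 5 6 (.red 1 [6, 5, 1, 0]) (.split 1 3 (.split 3 6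
    (.red 1 [6, 3, 1, 0]) (.split 3 7 (.red 1 [7, 3, 1, 0]) (.blue 0 [3, 7, 0, 4, 2, 8, 5, 6])))
    (.split 1 8 (.split 7 8 (.red 1 [7, 8, 1, 0]) (.split 3 8 (.red 1 [3, 8, 1, 0])
    (.blue 0 [3, 8, 7, 0, 4, 2, 6, 5]))) (.blue 0 [1, 8, 0, 4, 2, 6, 5, 3])))))) (.split 1 6
    (.split 6 7 (.red 1 [7, 6, 1, 0]) (.split 5 6 (.red 1 [5, 6, 1, 0]) (.split 4 6
    (.red 1 [4, 6, 1, 0]) (.split 1 8 (.split 4 8 (.red 1 [4, 8, 1, 0]) (.split 7 8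
    (.red 1 [7, 8, 1, 0]) (.blue 0 [7, 8, 4, 0, 3, 2, 5, 6])))
    (.blue 0 [1, 8, 0, 3, 2, 4, 6, 5]))))) (.split 3 7 (.split 1 3 (.red 1 [0, 1, 3, 7])
    (.split 6 7 (.split 4 6 (.red 1 [4, 6, 7, 3]) (.split 6 8 (.red 1 [8, 6, 7, 3])
    (.blue 0 [6, 8, 0, 3, 1, 5, 2, 4]))) (.split 4 6 (.split 3 4 (.red 1 [7, 3, 4, 6])
    (.blue 0 [3, 4, 0, 5, 1, 6, 7, 2])) (.blue 0 [4, 6, 7, 0, 3, 1, 5, 2])))) (.split 7 8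
    (.split 4 7 (.split 3 8 (.red 1 [3, 8, 7, 4]) (.blue 0 [3, 8, 0, 5, 1, 6, 2, 7]))
    (.blue 0 [4, 7, 3, 0, 5, 1, 6, 2])) (.blue 0 [7, 8, 0, 5, 1, 6, 2, 3])))))))))))))))),
  (.path 2,
    .split 0 7 (.red 2 [7, 0, 1]) (.split 1 3 (.red 2 [3, 1, 0]) (.split 1 4 (.red 2 [4, 1, 0])
    (.split 0 6 (.red 2 [6, 0, 1]) (.split 0 5 (.red 2 [5, 0, 1]) (.split 0 3 (.red 2 [3, 0, 1])
    (.split 2 7 (.split 2 6 (.red 2 [6, 2, 7]) (.split 2 5 (.red 2 [5, 2, 7]) (.split 6 7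
    (.red 2 [6, 7, 2]) (.split 4 7 (.red 2 [4, 7, 2]) (.blue 0 [4, 7, 6, 2, 5, 0, 3, 1])))))
    (.split 2 5 (.split 2 8 (.red 2 [8, 2, 5]) (.split 4 5 (.red 2 [4, 5, 2]) (.split 5 8
    (.red 2 [8, 5, 2]) (.blue 0 [5, 8, 2, 7, 0, 3, 1, 4])))) (.split 5 6 (.split 4 6
    (.red 2 [4, 6, 5]) (.split 6 7 (.red 2 [7, 6, 5]) (.blue 0 [6, 7, 2, 5, 0, 3, 1, 4])))
    (.split 4 7 (.split 4 6 (.red 2 [6, 4, 7]) (.blue 0 [4, 6, 5, 2, 7, 0, 3, 1]))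
    (.blue 0 [4, 7, 2, 5, 6, 0, 3, 1]))))))))))),
  (.empty,
    .split 5 6 (.red 3 [5, 6]) (.split 0 8 (.red 3 [0, 8]) (.split 2 6 (.red 3 [2, 6]) (.split 0 2
    (.red 3 [0, 2]) (.split 4 5 (.red 3 [4, 5]) (.split 3 4 (.red 3 [3, 4]) (.split 1 3
    (.red 3 [1, 3]) (.split 1 8 (.red 3 [1, 8]) (.blue 0 [1, 8, 0, 2, 6, 5, 4, 3])))))))))]

/-- The case analysis for red without `P₃` and blue without `C₈`, on `8` vertices. -/
def cases03 : List (Pattern × CaseTree) := [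
  (.path 2,
    .split 1 6 (.red 0 [6, 1, 0]) (.split 0 2 (.red 0 [2, 0, 1]) (.split 0 6 (.red 0 [6, 0, 1])
    (.split 0 5 (.red 0 [5, 0, 1]) (.split 0 3 (.red 0 [3, 0, 1]) (.split 1 2 (.red 0 [2, 1, 0])
    (.split 1 5 (.red 0 [5, 1, 0]) (.split 1 7 (.red 0 [7, 1, 0]) (.split 3 4 (.split 3 7
    (.red 0 [7, 3, 4]) (.split 4 5 (.red 0 [5, 4, 3]) (.split 3 6 (.red 0 [6, 3, 4]) (.split 4 7
    (.red 0 [7, 4, 3]) (.blue 0 [4, 7, 3, 6, 0, 2, 1, 5]))))) (.split 2 7 (.split 6 7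
    (.red 0 [6, 7, 2]) (.split 2 6 (.red 0 [6, 2, 7]) (.split 2 4 (.red 0 [4, 2, 7])
    (.blue 0 [2, 4, 3, 0, 5, 1, 7, 6])))) (.split 4 5 (.split 4 6 (.red 0 [6, 4, 5]) (.split 2 5
    (.red 0 [2, 5, 4]) (.blue 0 [2, 5, 0, 3, 4, 6, 1, 7]))) (.split 2 3 (.split 3 7
    (.red 0 [7, 3, 2]) (.blue 0 [3, 7, 2, 0, 6, 1, 5, 4]))
    (.blue 0 [2, 3, 4, 5, 0, 6, 1, 7]))))))))))))),
  (.empty,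
    .split 6 7 (.red 1 [6, 7]) (.split 0 3 (.red 1 [0, 3]) (.split 3 7 (.red 1 [3, 7]) (.split 2 4
    (.red 1 [2, 4]) (.split 1 6 (.red 1 [1, 6]) (.split 0 5 (.red 1 [0, 5]) (.split 1 4
    (.red 1 [1, 4]) (.split 2 5 (.red 1 [2, 5]) (.blue 0 [2, 5, 0, 3, 7, 6, 1, 4])))))))))]

/-- The case analysis for two colors without `P₅`, on `7` vertices. -/
def cases11 : List (Pattern × CaseTree) := [
  (.path 4,
    .split 3 5 (.red 0 [5, 3, 2, 1, 0]) (.split 3 6 (.red 0 [6, 3, 2, 1, 0]) (.split 0 5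
    (.red 0 [5, 0, 1, 2, 3]) (.split 0 4 (.red 0 [4, 0, 1, 2, 3]) (.blue 0 [4, 0, 5, 3, 6]))))),
  (.path 3,
    .split 2 4 (.red 1 [4, 2, 1, 0]) (.split 0 6 (.red 1 [6, 0, 1, 2]) (.split 0 4
    (.red 1 [4, 0, 1, 2]) (.blue 1 [6, 0, 4, 2])))),
  (.path 2,
    .split 0 2 (.red 2 [2, 0, 1]) (.split 0 6 (.red 2 [6, 0, 1]) (.blue 2 [6, 0, 2]))),
  (.empty,
    .split 1 6 (.red 3 [1, 6]) (.blue 3 [1, 6]))]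

/-- The case analysis for red without `P₃` and blue without `P₅`, on `6` vertices. -/
def cases01 : List (Pattern × CaseTree) := [
  (.path 2,
    .split 0 2 (.red 0 [2, 0, 1]) (.split 0 3 (.red 0 [3, 0, 1]) (.split 1 4 (.red 0 [4, 1, 0])
    (.split 1 3 (.red 0 [3, 1, 0]) (.blue 0 [4, 1, 3, 0, 2]))))),
  (.empty,
    .split 2 4 (.red 1 [2, 4]) (.split 1 2 (.red 1 [1, 2]) (.split 0 4 (.red 1 [0, 4]) (.split 1 3
    (.red 1 [1, 3]) (.blue 0 [3, 1, 2, 4, 0])))))]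

/-- The case analysis for two colors without `P₃`, on `5` vertices. -/
def cases00 : List (Pattern × CaseTree) := [
  (.empty,
    .split 0 4 (.split 3 4 (.red 0 [3, 4, 0]) (.split 1 4 (.red 0 [1, 4, 0]) (.blue 0 [1, 4, 3])))
    (.split 0 2 (.split 2 4 (.red 0 [4, 2, 0]) (.blue 0 [2, 4, 0])) (.blue 0 [2, 0, 4])))]

section Ramsey

variable {V : Type*} [Fintype V] {Red Blue : SimpleGraph V} {n : ℕ}

lemma targetGraph_of_checkRed (hn : n ≤ 16) (hn0 : 0 < n) (hV : n ≤ Fintype.card V)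
    (htot : ∀ u v, u ≠ v → Red.Adj u v ∨ Blue.Adj u v) {r b : Fin 4}
    {l : List (Pattern × CaseTree)} (hwr : (targetPattern r).wellFormed n)
    (hwb : (targetPattern b).wellFormed n)
    (hl : checkRed n [targetPattern r] [targetPattern b] l)
    (hempty : ∃ t, (Pattern.empty, t) ∈ l) : targetGraph r ⊑ Red ∨ targetGraph b ⊑ Blue := by
  by_contra hcon
  rw [not_or] at hcon
  obtain ⟨t, ht⟩ := hempty
  have : Nonempty V := Fintype.card_pos_iff.1 (by omega)
  refine not_occursIn_of_checkRed hn hV htot (FB := [targetPattern b]) ?_ ?_ hl _ ht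
    Pattern.empty_occursIn
  · simpa [hwb] using fun h => hcon.2 (targetGraph_isContained_of_occursIn h)
  · simpa [hwr] using fun h => hcon.1 (targetGraph_isContained_of_occursIn h)

lemma targetGraph_of_checkBoth (hn : n ≤ 16) (hn0 : 0 < n) (hV : n ≤ Fintype.card V)
    (htot : ∀ u v, u ≠ v → Red.Adj u v ∨ Blue.Adj u v) {r : Fin 4}
    {l : List (Pattern × CaseTree)} (hwr : (targetPattern r).wellFormed n)
    (hl : checkBoth n [targetPattern r] l)
    (hempty : ∃ t, (Pattern.empty, t) ∈ l) : targetGraph r ⊑ Red ∨ targetGraph r ⊑ Blue := by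
  by_contra hcon
  rw [not_or] at hcon
  obtain ⟨t, ht⟩ := hempty
  have : Nonempty V := Fintype.card_pos_iff.1 (by omega)
  refine not_occursIn_of_checkBoth hn hV htot ?_ hl _ ht Pattern.empty_occursIn
  simpa [hwr] using ⟨fun h => hcon.1 (targetGraph_isContained_of_occursIn h),
    fun h => hcon.2 (targetGraph_isContained_of_occursIn h)⟩

/-- The two-color Ramsey numbers of the graphs `P₃`, `P₅` and `C₈`: `r + b + 5` vertices suffice
for the pair `targetGraph r`, `targetGraph b`. An edge may have both colors. -/
theorem exists_target_of_two_colors (htot : ∀ u v, u ≠ v → Red.Adj u v ∨ Blue.Adj u v)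
    {r b : Fin 4} (hr : r ≠ 2) (hb : b ≠ 2) (hV : (r : ℕ) + b + 5 ≤ Fintype.card V) :
    targetGraph r ⊑ Red ∨ targetGraph b ⊑ Blue := by
  wlog hrb : r ≤ b generalizing Red Blue r b
  · exact (this (fun u v h => (htot u v h).symm) hb hr (by omega) (le_of_not_ge hrb)).symm
  have h : (r = 0 ∧ b = 0) ∨ (r = 0 ∧ b = 1) ∨ (r = 0 ∧ b = 3) ∨ (r = 1 ∧ b = 1) ∨
      (r = 1 ∧ b = 3) ∨ (r = 3 ∧ b = 3) := by
    clear hV htot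
    revert r b
    decide
  rcases h with ⟨rfl, rfl⟩ | ⟨rfl, rfl⟩ | ⟨rfl, rfl⟩ | ⟨rfl, rfl⟩ | ⟨rfl, rfl⟩ | ⟨rfl, rfl⟩
  · exact targetGraph_of_checkBoth (n := 5) (l := cases00) (by norm_num) (by norm_num) hV htot
      (by decide +kernel) (by decide +kernel) ⟨_, List.mem_of_getLast? rfl⟩
  · exact targetGraph_of_checkRed (n := 6) (l := cases01) (by norm_num) (by norm_num) hV htot
      (by decide +kernel) (by decide +kernel) (by decide +kernel) ⟨_, List.mem_of_getLast? rfl⟩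
  · exact targetGraph_of_checkRed (n := 8) (l := cases03) (by norm_num) (by norm_num) hV htot
      (by decide +kernel) (by decide +kernel) (by decide +kernel) ⟨_, List.mem_of_getLast? rfl⟩
  · exact targetGraph_of_checkBoth (n := 7) (l := cases11) (by norm_num) (by norm_num) hV htot
      (by decide +kernel) (by decide +kernel) ⟨_, List.mem_of_getLast? rfl⟩
  · exact targetGraph_of_checkRed (n := 9) (l := cases13) (by norm_num) (by norm_num) hV htot
      (by decide +kernel) (by decide +kernel) (by decide +kernel) ⟨_, List.mem_of_getLast? rfl⟩
  · exact targetGraph_of_checkBoth (n := 11) (l := cases33) (by norm_num) (by norm_num) hV htot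
      (by decide +kernel) (by decide +kernel) ⟨_, List.mem_of_getLast? rfl⟩

end Ramsey

/-! ### Uncolored edges inside a module -/

section Cycles

variable {V : Type*} {H : SimpleGraph V}

lemma false_of_cycle (hH : ¬ cycleGraph 8 ⊑ H) (a b c d e f g h : V)
    (hn : (a ≠ b ∧ a ≠ c ∧ a ≠ d ∧ a ≠ e ∧ a ≠ f ∧ a ≠ g ∧ a ≠ h) ∧
      (b ≠ c ∧ b ≠ d ∧ b ≠ e ∧ b ≠ f ∧ b ≠ g ∧ b ≠ h) ∧
      (c ≠ d ∧ c ≠ e ∧ c ≠ f ∧ c ≠ g ∧ c ≠ h) ∧ (d ≠ e ∧ d ≠ f ∧ d ≠ g ∧ d ≠ h) ∧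
      (e ≠ f ∧ e ≠ g ∧ e ≠ h) ∧ (f ≠ g ∧ f ≠ h) ∧ g ≠ h)
    (hadj : H.Adj a b ∧ H.Adj b c ∧ H.Adj c d ∧ H.Adj d e ∧ H.Adj e f ∧ H.Adj f g ∧ H.Adj g h ∧
      H.Adj h a) : False := by
  obtain ⟨h1, h2, h3, h4, h5, h6, h7, h8⟩ := hadj
  exact hH (cycleGraph_eight_isContained (p := [a, b, c, d, e, f, g, h]) (by simpa [and_assoc] using hn)
    (by simp [h1, h2, h3, h4, h5, h6, h7]) rfl h8)

end Cycles

/-- The situation around a module `D`. Its red neighbors form `R`, and the other vertices outside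
`D` form `B`; they are blue neighbors of `D`. Only edges inside `D`, `R` or `B` may be uncolored, and
two vertices of `R` that are not joined look the same from every vertex of `B`. -/
structure Sides {V : Type*} (Red Blue : SimpleGraph V) (D R B : Finset V) : Prop where
  red : ∀ d ∈ D, ∀ r ∈ R, Red.Adj d r
  blue : ∀ d ∈ D, ∀ b ∈ B, Blue.Adj d b
  not_red : ∀ d ∈ D, ∀ b ∈ B, ¬ Red.Adj d b
  cover : ∀ v, v ∈ D ∨ v ∈ R ∨ v ∈ B
  cross : ∀ r ∈ R, ∀ b ∈ B, Red.Adj r b ∨ Blue.Adj r b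
  twin : ∀ r ∈ R, ∀ r' ∈ R, r ≠ r' → ∀ b ∈ B, Red.Adj b r → ¬ Red.Adj b r' →
    Red.Adj r r' ∨ Blue.Adj r r'
  disjDR : ∀ d ∈ D, d ∉ R
  disjDB : ∀ d ∈ D, d ∉ B
  disjRB : ∀ r ∈ R, r ∉ B

namespace Sides

variable {V : Type*} {Red Blue : SimpleGraph V} {D R B : Finset V}

/-- If the edge `x y` inside `D` closes a red path `z₁ … z₆` to a cycle, then at least three of its
vertices lie in `B`: otherwise a cycle through `x`, `y` and two pieces of the path would be red. -/
lemma mem_of_six (S : Sides Red Blue D R B) (hR : ¬ cycleGraph 8 ⊑ Red)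
    {x y z₁ z₂ z₃ z₄ z₅ z₆ : V} (hx : x ∈ D) (hy : y ∈ D) (hxy : x ≠ y)
    (hz : [z₁, z₂, z₃, z₄, z₅, z₆].Nodup) (hzs : ∀ z ∈ [z₁, z₂, z₃, z₄, z₅, z₆], z ∈ R ∨ z ∈ B)
    (hz₁ : z₁ ∈ R) (hz₆ : z₆ ∈ R)
    (h₁₂ : Red.Adj z₁ z₂) (h₂₃ : Red.Adj z₂ z₃) (h₃₄ : Red.Adj z₃ z₄) (h₄₅ : Red.Adj z₄ z₅)
    (h₅₆ : Red.Adj z₅ z₆) : z₂ ∈ B ∧ z₅ ∈ B ∧ (z₃ ∈ B ∨ z₄ ∈ B) := by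
  have hne := hz
  simp only [List.nodup_cons, List.mem_cons, not_or, List.not_mem_nil] at hne
  have hred := S.red
  have hd := S.disjDR
  have hd' := S.disjDB
  refine ⟨?_, ?_, ?_⟩
  · by_contra h
    have h2 : z₂ ∈ R := (hzs z₂ (by simp)).resolve_right h
    exact false_of_cycle hR x z₁ y z₂ z₃ z₄ z₅ z₆ (by clear hz; grind (splits := 40)) (by grind [SimpleGraph.adj_comm])
  · by_contra h
    have h5 : z₅ ∈ R := (hzs z₅ (by simp)).resolve_right h
    exact false_of_cycle hR x z₁ z₂ z₃ z₄ z₅ y z₆ (by clear hz; grind (splits := 40)) (by grind [SimpleGraph.adj_comm])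
  · by_contra! h
    have h3 : z₃ ∈ R := (hzs z₃ (by simp)).resolve_right h.1
    have h4 : z₄ ∈ R := (hzs z₄ (by simp)).resolve_right h.2
    exact false_of_cycle hR x z₁ z₂ z₃ y z₄ z₅ z₆ (by clear hz; grind (splits := 40)) (by grind [SimpleGraph.adj_comm])

/-- In the situation of `mem_of_six`, two further vertices `u`, `u'` of `R` lead to a red or a blue
cycle if `z₃` lies in `R`: most edges from `u`, `u'` to the path are not red. -/
lemma false_of_six_of_mem (S : Sides Red Blue D R B) (hR : ¬ cycleGraph 8 ⊑ Red)
    (hB : ¬ cycleGraph 8 ⊑ Blue)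
    {x y z₁ z₂ z₃ z₄ z₅ z₆ u u' : V} (hx : x ∈ D) (hy : y ∈ D) (hxy : x ≠ y)
    (hz : [z₁, z₂, z₃, z₄, z₅, z₆, u, u'].Nodup) (hz₁ : z₁ ∈ R) (hz₂ : z₂ ∈ B) (hz₃ : z₃ ∈ R)
    (hz₄ : z₄ ∈ B) (hz₅ : z₅ ∈ B) (hz₆ : z₆ ∈ R) (hu : u ∈ R) (hu' : u' ∈ R)
    (h₁₂ : Red.Adj z₁ z₂) (h₂₃ : Red.Adj z₂ z₃) (h₃₄ : Red.Adj z₃ z₄) (h₄₅ : Red.Adj z₄ z₅)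
    (h₅₆ : Red.Adj z₅ z₆) : False := by
  have hne := hz
  simp only [List.nodup_cons, List.mem_cons, not_or, List.not_mem_nil] at hne
  have hred := S.red
  have hblue := S.blue
  have hd := S.disjDR
  have hd' := S.disjDB
  have hu4 : ¬ Red.Adj u z₄ := fun h =>
    false_of_cycle hR x u z₄ z₃ z₂ z₁ y u' (by clear hz; grind (splits := 40)) (by grind [SimpleGraph.adj_comm])
  have hu4' : ¬ Red.Adj u' z₄ := fun h =>
    false_of_cycle hR x u' z₄ z₃ z₂ z₁ y u (by clear hz; grind (splits := 40)) (by grind [SimpleGraph.adj_comm])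
  have hu3 : ¬ Red.Adj u z₃ := fun h =>
    false_of_cycle hR x u z₃ z₄ z₅ z₆ y u' (by clear hz; grind (splits := 40)) (by grind [SimpleGraph.adj_comm])
  have hu3' : ¬ Red.Adj u' z₃ := fun h =>
    false_of_cycle hR x u' z₃ z₄ z₅ z₆ y u (by clear hz; grind (splits := 40)) (by grind [SimpleGraph.adj_comm])
  have hu5' : ¬ Red.Adj u' z₅ := fun h =>
    false_of_cycle hR x u' z₅ z₆ y z₁ z₂ z₃ (by clear hz; grind (splits := 40)) (by grind [SimpleGraph.adj_comm])
  have b4 := (S.cross u hu z₄ hz₄).resolve_left hu4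
  have b5 := (S.cross u' hu' z₅ hz₅).resolve_left hu5'
  have b3 : Blue.Adj u z₃ := ((S.twin z₃ hz₃ u hu (by clear hz; grind (splits := 40)) z₄ hz₄ h₃₄.symm
    fun h => hu4 h.symm).resolve_left fun h => hu3 h.symm).symm
  have b3' : Blue.Adj u' z₃ := ((S.twin z₃ hz₃ u' hu' (by clear hz; grind (splits := 40)) z₄ hz₄ h₃₄.symm
    fun h => hu4' h.symm).resolve_left fun h => hu3' h.symm).symm
  exact false_of_cycle hB x z₄ u z₃ u' z₅ y z₂ (by clear hz; grind (splits := 40)) (by grind [SimpleGraph.adj_comm])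

/-- In the situation of `mem_of_six`, two further vertices `u`, `u'` of `R` lead to a red or a blue
cycle. -/
lemma false_of_six (S : Sides Red Blue D R B) (hR : ¬ cycleGraph 8 ⊑ Red)
    (hB : ¬ cycleGraph 8 ⊑ Blue)
    {x y z₁ z₂ z₃ z₄ z₅ z₆ u u' : V} (hx : x ∈ D) (hy : y ∈ D) (hxy : x ≠ y)
    (hz : [z₁, z₂, z₃, z₄, z₅, z₆, u, u'].Nodup)
    (hzs : ∀ z ∈ [z₁, z₂, z₃, z₄, z₅, z₆], z ∈ R ∨ z ∈ B)
    (hz₁ : z₁ ∈ R) (hz₆ : z₆ ∈ R) (hu : u ∈ R) (hu' : u' ∈ R)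
    (h₁₂ : Red.Adj z₁ z₂) (h₂₃ : Red.Adj z₂ z₃) (h₃₄ : Red.Adj z₃ z₄) (h₄₅ : Red.Adj z₄ z₅)
    (h₅₆ : Red.Adj z₅ z₆) : False := by
  obtain ⟨hz₂, hz₅, h34⟩ := S.mem_of_six hR hx hy hxy (by clear hzs; grind) hzs hz₁ hz₆ h₁₂ h₂₃ h₃₄ h₄₅ h₅₆
  have hne := hz
  simp only [List.nodup_cons, List.mem_cons, not_or, List.not_mem_nil] at hne
  have hred := S.red
  have hblue := S.blue
  have hd := S.disjDR
  have hd' := S.disjDB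
  have hd'' := S.disjRB
  by_cases h3 : z₃ ∈ R
  · have hz₄ : z₄ ∈ B := by grind
    exact S.false_of_six_of_mem hR hB hx hy hxy hz hz₁ hz₂ h3 hz₄ hz₅ hz₆ hu hu' h₁₂ h₂₃ h₃₄ h₄₅ h₅₆
  have hz₃ : z₃ ∈ B := (hzs z₃ (by simp)).resolve_left h3
  by_cases h4 : z₄ ∈ R
  · exact S.false_of_six_of_mem hR hB hx hy hxy (by clear hzs; grind) hz₆ hz₅ h4 hz₃ hz₂ hz₁ hu hu'
      h₅₆.symm h₄₅.symm h₃₄.symm h₂₃.symm h₁₂.symm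
  have hz₄ : z₄ ∈ B := (hzs z₄ (by simp)).resolve_left h4
  clear hzs
  -- Now `z₂, …, z₅` lie in `B`, and `u`, `u'` have no red edges to `z₃`, `z₄`.
  have key : ∀ {v v' : V}, v ∈ R → v' ∈ R → [z₁, z₂, z₃, z₄, z₅, z₆, v, v'].Nodup →
      Blue.Adj v z₃ ∧ Blue.Adj v z₄ := by
    intro v v' hv hv' hnd
    have hne' := hnd
    simp only [List.nodup_cons, List.mem_cons, not_or, List.not_mem_nil] at hne'
    have h3 : ¬ Red.Adj v z₃ := fun h =>
      false_of_cycle hR x v z₃ z₄ z₅ z₆ y v' (by clear hz hnd; grind (splits := 40)) (by grind [SimpleGraph.adj_comm])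
    have h4 : ¬ Red.Adj v z₄ := fun h =>
      false_of_cycle hR x v z₄ z₃ z₂ z₁ y v' (by clear hz hnd; grind (splits := 40)) (by grind [SimpleGraph.adj_comm])
    exact ⟨(S.cross v hv z₃ hz₃).resolve_left h3, (S.cross v hv z₄ hz₄).resolve_left h4⟩
  obtain ⟨b3, b4⟩ := key hu hu' hz
  obtain ⟨b3', b4'⟩ := key hu' hu (by clear key; grind)
  -- A further blue edge to `z₂` or `z₅` closes a blue cycle, hence these edges are red.
  have r2 : Red.Adj u' z₂ := (S.cross u' hu' z₂ hz₂).resolve_right fun h =>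
    false_of_cycle hB x z₃ u z₄ u' z₂ y z₅ (by clear hz; grind (splits := 40)) (by grind [SimpleGraph.adj_comm])
  have r5 : Red.Adj u z₅ := (S.cross u hu z₅ hz₅).resolve_right fun h =>
    false_of_cycle hB x z₃ u' z₄ u z₅ y z₂ (by clear hz; grind (splits := 40)) (by grind [SimpleGraph.adj_comm])
  exact false_of_cycle hR x z₁ z₂ u' y u z₅ z₆ (by clear hz; grind (splits := 40)) (by grind [SimpleGraph.adj_comm])

/-- If `D` has a third vertex `w`, then already one further vertex of `R` closes a red cycle unless
`z₃` and `z₄` lie in `B`. -/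
lemma mem_of_six_of_three (S : Sides Red Blue D R B) (hR : ¬ cycleGraph 8 ⊑ Red)
    {x y w z₁ z₂ z₃ z₄ z₅ z₆ u : V} (hx : x ∈ D) (hy : y ∈ D) (hw : w ∈ D)
    (hxyw : [x, y, w].Nodup) (hz : [z₁, z₂, z₃, z₄, z₅, z₆, u].Nodup)
    (hz₁ : z₁ ∈ R) (hz₆ : z₆ ∈ R) (hu : u ∈ R)
    (h₁₂ : Red.Adj z₁ z₂) (h₂₃ : Red.Adj z₂ z₃) (h₄₅ : Red.Adj z₄ z₅) (h₅₆ : Red.Adj z₅ z₆)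
    (hzs : ∀ z ∈ [z₂, z₃, z₄, z₅], z ∈ R ∨ z ∈ B) : z₃ ∈ B ∧ z₄ ∈ B := by
  have hne := hz
  simp only [List.nodup_cons, List.mem_cons, not_or, List.not_mem_nil] at hne
  have hred := S.red
  have hd := S.disjDR
  have hd' := S.disjDB
  constructor
  · refine (hzs z₃ (by simp)).resolve_left fun h => ?_
    have h2 := hzs z₂ (by simp)
    exact false_of_cycle hR x z₁ z₂ z₃ y z₆ w u (by clear hz; grind (splits := 40)) (by grind [SimpleGraph.adj_comm])
  · refine (hzs z₄ (by simp)).resolve_left fun h => ?_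
    have h5 := hzs z₅ (by simp)
    exact false_of_cycle hR x z₆ z₅ z₄ y z₁ w u (by clear hz; grind (splits := 40)) (by grind [SimpleGraph.adj_comm])

/-- The edges `x y` and `y w` inside `D` close a red path `z₁ … z₅` to a cycle: all of `R` lies on
the path, and at least two vertices of the path lie in `B`. -/
lemma mem_of_five (S : Sides Red Blue D R B) (hR : ¬ cycleGraph 8 ⊑ Red)
    {x y w z₁ z₂ z₃ z₄ z₅ : V} (hx : x ∈ D) (hy : y ∈ D) (hw : w ∈ D)
    (hxyw : [x, y, w].Nodup) (hz : [z₁, z₂, z₃, z₄, z₅].Nodup)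
    (hz₁ : z₁ ∈ R) (hz₅ : z₅ ∈ R) (hzs : ∀ z ∈ [z₂, z₃, z₄], z ∈ R ∨ z ∈ B)
    (h₁₂ : Red.Adj z₁ z₂) (h₂₃ : Red.Adj z₂ z₃) (h₃₄ : Red.Adj z₃ z₄) (h₄₅ : Red.Adj z₄ z₅) :
    (∀ u ∈ R, u ∈ [z₁, z₂, z₃, z₄, z₅]) ∧
      ((z₂ ∈ B ∧ z₃ ∈ B) ∨ (z₂ ∈ B ∧ z₄ ∈ B) ∨ (z₃ ∈ B ∧ z₄ ∈ B)) := by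
  have hne := hz
  simp only [List.nodup_cons, List.mem_cons, not_or, List.not_mem_nil] at hne
  have hred := S.red
  have hd := S.disjDR
  have hd' := S.disjDB
  have h2 := hzs z₂ (by simp)
  have h3 := hzs z₃ (by simp)
  have h4 := hzs z₄ (by simp)
  constructor
  · intro u hu
    by_contra h
    exact false_of_cycle hR x z₁ z₂ z₃ z₄ z₅ y u (by clear hz; grind (splits := 40)) (by grind [SimpleGraph.adj_comm])
  · have h23 : ¬ (z₂ ∈ R ∧ z₃ ∈ R) := fun h =>
      false_of_cycle hR x z₁ y z₂ w z₅ z₄ z₃ (by clear hz; grind (splits := 40))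
        (by grind [SimpleGraph.adj_comm])
    have h34 : ¬ (z₃ ∈ R ∧ z₄ ∈ R) := fun h =>
      false_of_cycle hR x z₅ y z₄ w z₁ z₂ z₃ (by clear hz; grind (splits := 40))
        (by grind [SimpleGraph.adj_comm])
    have h24 : ¬ (z₂ ∈ R ∧ z₄ ∈ R) := fun h =>
      false_of_cycle hR x z₁ y z₂ z₃ z₄ w z₅ (by clear hz; grind (splits := 40))
        (by grind [SimpleGraph.adj_comm])
    grind

/-- The edge `x y` inside `D` closes the red path `u₀ w z₁ … z₄` to a cycle, where `w` lies in `D`: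
then `z₂` and `z₃` lie in `B`. -/
lemma mem_of_four (S : Sides Red Blue D R B) (hR : ¬ cycleGraph 8 ⊑ Red)
    {x y w u₀ z₁ z₂ z₃ z₄ : V} (hx : x ∈ D) (hy : y ∈ D) (hw : w ∈ D)
    (hxyw : [x, y, w].Nodup) (hz : [u₀, z₁, z₂, z₃, z₄].Nodup) (hu₀ : u₀ ∈ R)
    (hz₁ : z₁ ∈ R) (hz₄ : z₄ ∈ R) (hz₂ : z₂ ∈ R ∨ z₂ ∈ B) (hz₃ : z₃ ∈ R ∨ z₃ ∈ B)
    (h₁₂ : Red.Adj z₁ z₂) (h₂₃ : Red.Adj z₂ z₃) (h₃₄ : Red.Adj z₃ z₄) : z₂ ∈ B ∧ z₃ ∈ B := by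
  simp only [List.nodup_cons, List.mem_cons, not_or, List.not_mem_nil] at hz hxyw
  have hred := S.red
  have hd := S.disjDR
  have hd' := S.disjDB
  constructor
  · exact hz₂.resolve_left fun h =>
      false_of_cycle hR x u₀ y z₁ w z₂ z₃ z₄ (by grind (splits := 40))
        (by grind [SimpleGraph.adj_comm])
  · exact hz₃.resolve_left fun h =>
      false_of_cycle hR x u₀ y z₄ w z₃ z₂ z₁ (by grind (splits := 40))
        (by grind [SimpleGraph.adj_comm])

/-- In the situation of `mem_of_four`, vertices of `R` outside the path have blue edges to `z₂` and
`z₃`, and also to `z₁` and `z₄`, because these look different from `z₂` and `z₃`, respectively. -/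
lemma blue_of_four (S : Sides Red Blue D R B) (hR : ¬ cycleGraph 8 ⊑ Red)
    {x y w u u' z₁ z₂ z₃ z₄ : V} (hx : x ∈ D) (hy : y ∈ D) (hw : w ∈ D)
    (hxyw : [x, y, w].Nodup) (hz : [u, u', z₁, z₂, z₃, z₄].Nodup) (hu : u ∈ R) (hu' : u' ∈ R)
    (hz₁ : z₁ ∈ R) (hz₄ : z₄ ∈ R) (hz₂ : z₂ ∈ B) (hz₃ : z₃ ∈ B)
    (h₁₂ : Red.Adj z₁ z₂) (h₂₃ : Red.Adj z₂ z₃) (h₃₄ : Red.Adj z₃ z₄) :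
    Blue.Adj u z₁ ∧ Blue.Adj u z₂ ∧ Blue.Adj u z₃ ∧ Blue.Adj u z₄ := by
  simp only [List.nodup_cons, List.mem_cons, not_or, List.not_mem_nil] at hz hxyw
  have hred := S.red
  have hd := S.disjDR
  have hd' := S.disjDB
  have r1 : ¬ Red.Adj u z₁ := fun h =>
    false_of_cycle hR x u z₁ z₂ z₃ z₄ y u' (by grind (splits := 40))
      (by grind [SimpleGraph.adj_comm])
  have r4 : ¬ Red.Adj u z₄ := fun h =>
    false_of_cycle hR x u z₄ z₃ z₂ z₁ y u' (by grind (splits := 40))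
      (by grind [SimpleGraph.adj_comm])
  have r2 : ¬ Red.Adj u z₂ := fun h =>
    false_of_cycle hR x z₁ z₂ u y u' w z₄ (by grind (splits := 40))
      (by grind [SimpleGraph.adj_comm])
  have r3 : ¬ Red.Adj u z₃ := fun h =>
    false_of_cycle hR x z₄ z₃ u y u' w z₁ (by grind (splits := 40))
      (by grind [SimpleGraph.adj_comm])
  exact ⟨((S.twin z₁ hz₁ u hu (by grind) z₂ hz₂ h₁₂.symm fun h => r2 h.symm).resolve_left
      fun h => r1 h.symm).symm, (S.cross u hu z₂ hz₂).resolve_left r2,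
    (S.cross u hu z₃ hz₃).resolve_left r3,
    ((S.twin z₄ hz₄ u hu (by grind) z₃ hz₃ h₃₄ fun h => r3 h.symm).resolve_left
      fun h => r4 h.symm).symm⟩

/-- The possible shapes of a cycle on eight vertices that consists of red edges and edges
inside `D`, up to rotation and reflection, if there is no red cycle. -/
lemma exists_of_filled_cycle (S : Sides Red Blue D R B) (hR : ¬ cycleGraph 8 ⊑ Red)
    (hD : D.card ≤ 3) {f : Fin 8 → V} (hf : Function.Injective f)
    (hadj : ∀ i, Red.Adj (f i) (f (i + 1)) ∨ (f i ∈ D ∧ f (i + 1) ∈ D)) :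
    (∃ x y z₁ z₂ z₃ z₄ z₅ z₆, x ∈ D ∧ y ∈ D ∧ x ≠ y ∧ [z₁, z₂, z₃, z₄, z₅, z₆].Nodup ∧
      (∀ z ∈ [z₁, z₂, z₃, z₄, z₅, z₆], z ∈ R ∨ z ∈ B) ∧ z₁ ∈ R ∧ z₆ ∈ R ∧
      Red.Adj z₁ z₂ ∧ Red.Adj z₂ z₃ ∧ Red.Adj z₃ z₄ ∧ Red.Adj z₄ z₅ ∧ Red.Adj z₅ z₆) ∨
    (∃ x y w z₁ z₂ z₃ z₄ z₅, x ∈ D ∧ y ∈ D ∧ w ∈ D ∧ [x, y, w].Nodup ∧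
      [z₁, z₂, z₃, z₄, z₅].Nodup ∧ z₁ ∈ R ∧ z₅ ∈ R ∧ (∀ z ∈ [z₂, z₃, z₄], z ∈ R ∨ z ∈ B) ∧
      Red.Adj z₁ z₂ ∧ Red.Adj z₂ z₃ ∧ Red.Adj z₃ z₄ ∧ Red.Adj z₄ z₅) ∨
    (∃ x y w u₀ z₁ z₂ z₃ z₄, x ∈ D ∧ y ∈ D ∧ w ∈ D ∧ [x, y, w].Nodup ∧
      [u₀, z₁, z₂, z₃, z₄].Nodup ∧ u₀ ∈ R ∧ z₁ ∈ R ∧ z₄ ∈ R ∧ (z₂ ∈ R ∨ z₂ ∈ B) ∧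
      (z₃ ∈ R ∨ z₃ ∈ B) ∧ Red.Adj z₁ z₂ ∧ Red.Adj z₂ z₃ ∧ Red.Adj z₃ z₄) := by
  classical
  -- Rotate the cycle such that `f 0` and `f 1` are not joined by a red edge.
  obtain ⟨i₀, hi₀⟩ : ∃ i, ¬ Red.Adj (f i) (f (i + 1)) := by
    by_contra! h
    exact hR ⟨⟨⟨f, fun {a b} hab => by
      rcases cycleGraph_adj.1 hab with h' | h'
      · have := (h b).symm
        rwa [← h', add_sub_cancel] at this
      · have := h a
        rwa [← h', add_sub_cancel] at this⟩, hf⟩⟩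
  obtain ⟨g, hg, hgadj, hg0, hg1⟩ : ∃ g : Fin 8 → V, Function.Injective g ∧
      (∀ i, Red.Adj (g i) (g (i + 1)) ∨ (g i ∈ D ∧ g (i + 1) ∈ D)) ∧ g 0 ∈ D ∧ g 1 ∈ D := by
    refine ⟨fun i => f (i₀ + i), hf.comp (add_right_injective i₀), fun i => ?_, ?_, ?_⟩
    · simpa [add_assoc] using hadj (i₀ + i)
    · simpa using ((hadj i₀).resolve_left hi₀).1
    · simpa using ((hadj i₀).resolve_left hi₀).2
  have hcov : ∀ i, g i ∉ D → g i ∈ R ∨ g i ∈ B := fun i hi => (S.cover (g i)).resolve_left hi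
  have hnext : ∀ i, g i ∉ D → Red.Adj (g i) (g (i + 1)) := fun i hi =>
    (hgadj i).resolve_right fun h => hi h.1
  have hprev : ∀ i, g (i + 1) ∉ D → Red.Adj (g i) (g (i + 1)) := fun i hi =>
    (hgadj i).resolve_right fun h => hi h.2
  have hRr : ∀ i, g i ∈ D → g (i + 1) ∉ D → g (i + 1) ∈ R := fun i hi hi' =>
    (hcov _ hi').resolve_right fun h => S.not_red _ hi _ h (hprev i hi')
  have hRl : ∀ i, g i ∉ D → g (i + 1) ∈ D → g i ∈ R := fun i hi hi' =>
    (hcov _ hi).resolve_right fun h => S.not_red _ hi' _ h (hnext i hi).symm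
  -- At most one further vertex of the cycle lies in `D`.
  have hone : ∀ i j, 2 ≤ i → 2 ≤ j → i ≠ j → g i ∈ D → g j ∉ D := by
    intro i j hi hj hij hgi hgj
    have hsub : ({g 0, g 1, g i, g j} : Finset V) ⊆ D := by
      intro v hv
      simp only [Finset.mem_insert, Finset.mem_singleton] at hv
      rcases hv with rfl | rfl | rfl | rfl <;> assumption
    have hc := Finset.card_le_card hsub
    rw [show ({g 0, g 1, g i, g j} : Finset V) = ({0, 1, i, j} : Finset (Fin 8)).image g by
      simp [Finset.image_insert], Finset.card_image_of_injective _ hg] at hc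
    have h4 : ({0, 1, i, j} : Finset (Fin 8)).card = 4 := by
      clear hc hsub hgi hgj
      revert i j
      decide
    omega
  have hne : ∀ l : List (Fin 8), l.Nodup → (l.map g).Nodup := fun l hl => hl.map hg
  by_cases h2 : g 2 ∈ D
  · have h3 := hone 2 3 (by decide) (by decide) (by decide) h2
    have h4 := hone 2 4 (by decide) (by decide) (by decide) h2
    have h5 := hone 2 5 (by decide) (by decide) (by decide) h2
    have h6 := hone 2 6 (by decide) (by decide) (by decide) h2
    have h7 := hone 2 7 (by decide) (by decide) (by decide) h2
    exact Or.inr <| Or.inl ⟨g 0, g 1, g 2, g 3, g 4, g 5, g 6, g 7, hg0, hg1, h2,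
      hne [0, 1, 2] (by decide), hne [3, 4, 5, 6, 7] (by decide), hRr 2 h2 h3, hRl 7 h7 hg0,
      by simp [hcov 4 h4, hcov 5 h5, hcov 6 h6], hnext 3 h3, hnext 4 h4, hnext 5 h5, hnext 6 h6⟩
  by_cases h7 : g 7 ∈ D
  · have h3 := hone 7 3 (by decide) (by decide) (by decide) h7
    have h4 := hone 7 4 (by decide) (by decide) (by decide) h7
    have h5 := hone 7 5 (by decide) (by decide) (by decide) h7
    have h6 := hone 7 6 (by decide) (by decide) (by decide) h7
    exact Or.inr <| Or.inl ⟨g 7, g 0, g 1, g 2, g 3, g 4, g 5, g 6, h7, hg0, hg1,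
      hne [7, 0, 1] (by decide), hne [2, 3, 4, 5, 6] (by decide), hRr 1 hg1 h2, hRl 6 h6 h7,
      by simp [hcov 3 h3, hcov 4 h4, hcov 5 h5], hnext 2 h2, hnext 3 h3, hnext 4 h4, hnext 5 h5⟩
  by_cases h3 : g 3 ∈ D
  · have h4 := hone 3 4 (by decide) (by decide) (by decide) h3
    have h5 := hone 3 5 (by decide) (by decide) (by decide) h3
    have h6 := hone 3 6 (by decide) (by decide) (by decide) h3
    exact Or.inr <| Or.inr ⟨g 0, g 1, g 3, g 2, g 4, g 5, g 6, g 7, hg0, hg1, h3,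
      hne [0, 1, 3] (by decide), hne [2, 4, 5, 6, 7] (by decide), hRr 1 hg1 h2, hRr 3 h3 h4,
      hRl 7 h7 hg0, hcov 5 h5, hcov 6 h6, hnext 4 h4, hnext 5 h5, hnext 6 h6⟩
  by_cases h6 : g 6 ∈ D
  · have h4 := hone 6 4 (by decide) (by decide) (by decide) h6
    have h5 := hone 6 5 (by decide) (by decide) (by decide) h6
    exact Or.inr <| Or.inr ⟨g 1, g 0, g 6, g 7, g 5, g 4, g 3, g 2, hg1, hg0, h6,
      hne [1, 0, 6] (by decide), hne [7, 5, 4, 3, 2] (by decide), hRl 7 h7 hg0, hRl 5 h5 h6,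
      hRr 1 hg1 h2, hcov 4 h4, hcov 3 h3, (hnext 4 h4).symm, (hnext 3 h3).symm, (hnext 2 h2).symm⟩
  by_cases h4 : g 4 ∈ D
  · have h5 := hone 4 5 (by decide) (by decide) (by decide) h4
    refine (false_of_cycle hR (g 0) (g 2) (g 1) (g 3) (g 4) (g 5) (g 6) (g 7)
      (by simp [hg.eq_iff]) ⟨S.red _ hg0 _ (hRr 1 hg1 h2), (S.red _ hg1 _ (hRr 1 hg1 h2)).symm,
      S.red _ hg1 _ (hRl 3 h3 h4), (S.red _ h4 _ (hRl 3 h3 h4)).symm, hprev 4 h5, hnext 5 h5,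
      hnext 6 h6, (S.red _ hg0 _ (hRl 7 h7 hg0)).symm⟩).elim
  by_cases h5 : g 5 ∈ D
  · refine (false_of_cycle hR (g 1) (g 7) (g 0) (g 6) (g 5) (g 4) (g 3) (g 2)
      (by simp [hg.eq_iff]) ⟨S.red _ hg1 _ (hRl 7 h7 hg0), (S.red _ hg0 _ (hRl 7 h7 hg0)).symm,
      S.red _ hg0 _ (hRr 5 h5 h6), (S.red _ h5 _ (hRr 5 h5 h6)).symm, (hnext 4 h4).symm,
      (hnext 3 h3).symm, (hnext 2 h2).symm, (S.red _ hg1 _ (hRr 1 hg1 h2)).symm⟩).elim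
  exact Or.inl ⟨g 0, g 1, g 2, g 3, g 4, g 5, g 6, g 7, hg0, hg1, hg.ne (by decide),
    hne [2, 3, 4, 5, 6, 7] (by decide), by
      simp [hcov 2 h2, hcov 3 h3, hcov 4 h4, hcov 5 h5, hcov 6 h6, hcov 7 h7], hRr 1 hg1 h2,
    hRl 7 h7 hg0, hnext 2 h2, hnext 3 h3, hnext 4 h4, hnext 5 h5, hnext 6 h6⟩

/-- If filling `D` with red edges creates a red cycle, then `B` is not too small. -/
lemma five_le_card_add_card (S : Sides Red Blue D R B) (hR : ¬ cycleGraph 8 ⊑ Red)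
    (hD : D.card ≤ 3) {f : Fin 8 → V} (hf : Function.Injective f)
    (hadj : ∀ i, Red.Adj (f i) (f (i + 1)) ∨ (f i ∈ D ∧ f (i + 1) ∈ D)) :
    5 ≤ D.card + B.card := by
  classical
  have h2 : ∀ {a b : V}, a ∈ B → b ∈ B → a ≠ b → 2 ≤ B.card := fun ha hb hab =>
    (Finset.card_pair hab).symm.trans_le (Finset.card_le_card (by
      simp [Finset.insert_subset_iff, ha, hb]))
  have h3 : ∀ {a b c : V}, [a, b, c].Nodup → a ∈ D → b ∈ D → c ∈ D → 3 ≤ D.card := by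
    intro a b c h ha hb hc
    rw [← show ([a, b, c].toFinset).card = 3 from List.toFinset_card_of_nodup h]
    exact Finset.card_le_card (by simp [Finset.insert_subset_iff, ha, hb, hc])
  rcases S.exists_of_filled_cycle hR hD hf hadj with
    ⟨x, y, z₁, z₂, z₃, z₄, z₅, z₆, hx, hy, hxy, hz, hzs, hz₁, hz₆, h₁₂, h₂₃, h₃₄, h₄₅, h₅₆⟩ |
    ⟨x, y, w, z₁, z₂, z₃, z₄, z₅, hx, hy, hw, hxyw, hz, hz₁, hz₅, hzs, h₁₂, h₂₃, h₃₄, h₄₅⟩ |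
    ⟨x, y, w, u₀, z₁, z₂, z₃, z₄, hx, hy, hw, hxyw, hz, hu₀, hz₁, hz₄, hz₂, hz₃, h₁₂, h₂₃, h₃₄⟩
  · obtain ⟨h2, h5, h34⟩ := S.mem_of_six hR hx hy hxy hz hzs hz₁ hz₆ h₁₂ h₂₃ h₃₄ h₄₅ h₅₆
    have hD2 : 2 ≤ D.card := (Finset.card_pair hxy).symm.trans_le (Finset.card_le_card (by
      simp [Finset.insert_subset_iff, hx, hy]))
    obtain ⟨t, ht, htB⟩ : ∃ t, [z₂, z₅, t].Nodup ∧ t ∈ B := by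
      simp only [List.nodup_cons, List.mem_cons, not_or, List.not_mem_nil] at hz
      rcases h34 with h | h
      · exact ⟨z₃, by simp; tauto, h⟩
      · exact ⟨z₄, by simp; tauto, h⟩
    have : 3 ≤ B.card := by
      rw [← show ([z₂, z₅, t].toFinset).card = 3 from List.toFinset_card_of_nodup ht]
      exact Finset.card_le_card (by simp [Finset.insert_subset_iff, h2, h5, htB])
    omega
  · have hD3 := h3 hxyw hx hy hw
    have : 2 ≤ B.card := by
      simp only [List.nodup_cons, List.mem_cons, not_or, List.not_mem_nil] at hz
      rcases (S.mem_of_five hR hx hy hw hxyw (by simpa using hz) hz₁ hz₅ hzs h₁₂ h₂₃ h₃₄ h₄₅).2 with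
        ⟨h, h'⟩ | ⟨h, h'⟩ | ⟨h, h'⟩ <;> exact h2 h h' (by tauto)
    omega
  · have hD3 := h3 hxyw hx hy hw
    obtain ⟨h, h'⟩ := S.mem_of_four hR hx hy hw hxyw hz hu₀ hz₁ hz₄ hz₂ hz₃ h₁₂ h₂₃ h₃₄
    have := h2 h h' h₂₃.ne
    omega

/-- If filling `D` with red edges creates a red cycle, then there is a red or a blue cycle, provided
that `R` is large. -/
lemma false_of_filled_cycle (S : Sides Red Blue D R B) (hR : ¬ cycleGraph 8 ⊑ Red)
    (hB : ¬ cycleGraph 8 ⊑ Blue) (hD : D.card ≤ 3)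
    (hRcard : 7 ≤ D.card + R.card) (hcard : 11 ≤ D.card + R.card + B.card)
    {f : Fin 8 → V} (hf : Function.Injective f)
    (hadj : ∀ i, Red.Adj (f i) (f (i + 1)) ∨ (f i ∈ D ∧ f (i + 1) ∈ D)) : False := by
  classical
  have hpick : ∀ (E : Finset V) (l : List V) (n : ℕ), l.length + n ≤ E.card →
      n ≤ (E \ l.toFinset).card := by
    intro E l n h
    have h1 := Finset.le_card_sdiff l.toFinset E
    have h2 := l.toFinset_card_le
    omega
  rcases S.exists_of_filled_cycle hR hD hf hadj with
    ⟨x, y, z₁, z₂, z₃, z₄, z₅, z₆, hx, hy, hxy, hz, hzs, hz₁, hz₆, h₁₂, h₂₃, h₃₄, h₄₅, h₅₆⟩ |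
    ⟨x, y, w, z₁, z₂, z₃, z₄, z₅, hx, hy, hw, hxyw, hz, hz₁, hz₅, hzs, h₁₂, h₂₃, h₃₄, h₄₅⟩ |
    ⟨x, y, w, u₀, z₁, z₂, z₃, z₄, hx, hy, hw, hxyw, hz, hu₀, hz₁, hz₄, hz₂, hz₃, h₁₂, h₂₃, h₃₄⟩
  · obtain ⟨h2, h5, h34⟩ := S.mem_of_six hR hx hy hxy hz hzs hz₁ hz₆ h₁₂ h₂₃ h₃₄ h₄₅ h₅₆
    have hRB := S.disjRB
    -- Two vertices of `R` outside the path give a contradiction.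
    have htwo : ∀ u ∈ R, ∀ u' ∈ R, u ≠ u' → u ∉ [z₁, z₃, z₄, z₆] → u' ∉ [z₁, z₃, z₄, z₆] →
        False := by
      intro u hu u' hu' huu' hn hn'
      refine S.false_of_six hR hB hx hy hxy (u := u) (u' := u') ?_ hzs hz₁ hz₆ hu hu' h₁₂ h₂₃ h₃₄
        h₄₅ h₅₆
      have h2u := hRB u hu
      have h2u' := hRB u' hu'
      clear hzs hRB
      simp only [List.nodup_cons, List.mem_cons, not_or, List.not_mem_nil] at hz hn hn' ⊢
      grind (splits := 40)
    by_cases hD2 : D.card = 2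
    · obtain ⟨t, ht⟩ : ∃ t, ∀ u ∈ R, u ∉ [z₁, z₆, t] → u ∉ [z₁, z₃, z₄, z₆] := by
        rcases h34 with h | h
        · exact ⟨z₄, fun u hu hn => by clear hzs; grind⟩
        · exact ⟨z₃, fun u hu hn => by clear hzs; grind⟩
      obtain ⟨u, hu, u', hu', huu'⟩ := Finset.one_lt_card.1
        (hpick R [z₁, z₆, t] 2 (by simp; omega))
      rw [Finset.mem_sdiff, List.mem_toFinset] at hu hu'
      exact htwo u hu.1 u' hu'.1 huu' (ht u hu.1 hu.2) (ht u' hu'.1 hu'.2)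
    · have hxyD : ({x, y} : Finset V) ⊆ D := by simp [Finset.insert_subset_iff, hx, hy]
      have hD3 : D.card = 3 := by
        have := Finset.card_le_card hxyD
        rw [Finset.card_pair hxy] at this
        omega
      obtain ⟨w, hw⟩ := Finset.card_pos.1 (hpick D [x, y] 1 (by simp; omega))
      rw [Finset.mem_sdiff, List.mem_toFinset] at hw
      have hzR : z₃ ∈ B ∧ z₄ ∈ B := by
        obtain ⟨t, ht⟩ : ∃ t, ∀ u ∈ R, u ∉ [z₁, z₆, t] → u ∉ [z₁, z₂, z₃, z₄, z₅, z₆] := by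
          rcases h34 with h | h
          · exact ⟨z₄, fun u hu hn => by clear hzs; grind⟩
          · exact ⟨z₃, fun u hu hn => by clear hzs; grind⟩
        obtain ⟨u, hu⟩ := Finset.card_pos.1 (hpick R [z₁, z₆, t] 1 (by simp; omega))
        rw [Finset.mem_sdiff, List.mem_toFinset] at hu
        have hun := ht u hu.1 hu.2
        refine S.mem_of_six_of_three hR hx hy hw.1 (u := u) ?_ ?_ hz₁ hz₆ hu.1 h₁₂ h₂₃ h₄₅ h₅₆ ?_
        · have := hw.2
          clear hzs
          grind
        · clear hzs
          simp only [List.nodup_cons, List.mem_cons, not_or, List.not_mem_nil] at hz hun ⊢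
          grind (splits := 40)
        · intro z hz'
          refine hzs z ?_
          simp only [List.mem_cons, List.not_mem_nil] at hz' ⊢
          tauto
      have ht : ∀ u ∈ R, u ∉ [z₁, z₆] → u ∉ [z₁, z₃, z₄, z₆] := fun u hu hn => by
        clear hzs
        grind
      obtain ⟨u, hu, u', hu', huu'⟩ := Finset.one_lt_card.1
        (hpick R [z₁, z₆] 2 (by simp; omega))
      rw [Finset.mem_sdiff, List.mem_toFinset] at hu hu'
      exact htwo u hu.1 u' hu'.1 huu' (ht u hu.1 hu.2) (ht u' hu'.1 hu'.2)
  · obtain ⟨hsub, h⟩ := S.mem_of_five hR hx hy hw hxyw hz hz₁ hz₅ hzs h₁₂ h₂₃ h₃₄ h₄₅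
    have hRB := S.disjRB
    obtain ⟨t, ht⟩ : ∃ t, ∀ u ∈ R, u ∈ [z₁, z₅, t] := by
      rcases h with ⟨h, h'⟩ | ⟨h, h'⟩ | ⟨h, h'⟩
      · exact ⟨z₄, fun u hu => by have := hsub u hu; have := hRB u hu; clear hzs hsub hRB; grind⟩
      · exact ⟨z₃, fun u hu => by have := hsub u hu; have := hRB u hu; clear hzs hsub hRB; grind⟩
      · exact ⟨z₂, fun u hu => by have := hsub u hu; have := hRB u hu; clear hzs hsub hRB; grind⟩
    have hc : R.card ≤ 3 :=
      (Finset.card_le_card fun u hu => List.mem_toFinset.2 (ht u hu)).trans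
        ([z₁, z₅, t].toFinset_card_le)
    omega
  · obtain ⟨h2, h3⟩ := S.mem_of_four hR hx hy hw hxyw hz hu₀ hz₁ hz₄ hz₂ hz₃ h₁₂ h₂₃ h₃₄
    have hRB := S.disjRB
    have hDB := S.disjDB
    have hDR := S.disjDR
    have hblueD := S.blue
    have hz' : [z₁, z₂, z₃, z₄].Nodup := by grind
    simp only [List.nodup_cons, List.mem_cons, not_or, List.not_mem_nil] at hz'
    have hblue : ∀ u ∈ R, ∀ u' ∈ R, u ≠ u' → u ∉ [z₁, z₄] → u' ∉ [z₁, z₄] →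
        Blue.Adj u z₁ ∧ Blue.Adj u z₂ ∧ Blue.Adj u z₃ ∧ Blue.Adj u z₄ := by
      intro u hu u' hu' huu' hn hn'
      have h2u := hRB u hu
      have h2u' := hRB u' hu'
      refine S.blue_of_four hR hx hy hw hxyw ?_ hu hu' hz₁ hz₄ h2 h3 h₁₂ h₂₃ h₃₄
      simp only [List.nodup_cons, List.mem_cons, not_or, List.not_mem_nil] at hn hn' ⊢
      grind (splits := 40)
    obtain ⟨u, hu, u', hu', huu'⟩ := Finset.one_lt_card.1 (hpick R [z₁, z₄] 2 (by simp; omega))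
    rw [Finset.mem_sdiff, List.mem_toFinset] at hu hu'
    obtain ⟨b1, b2, b3, b4⟩ := hblue u hu.1 u' hu'.1 huu' hu.2 hu'.2
    by_cases hR5 : 5 ≤ R.card
    · obtain ⟨u'', hu''⟩ := Finset.card_pos.1 (hpick R [z₁, z₄, u, u'] 1 (by simp; omega))
      rw [Finset.mem_sdiff, List.mem_toFinset] at hu''
      obtain ⟨b1', b2', b3', b4'⟩ := hblue u' hu'.1 u hu.1 huu'.symm hu'.2 hu.2
      obtain ⟨b1'', b2'', b3'', b4''⟩ := hblue u'' hu''.1 u hu.1 (by grind) (by grind) hu.2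
      have e := hRB u hu.1
      have e' := hRB u' hu'.1
      have e'' := hRB u'' hu''.1
      have hux := hDR x hx
      have hbx := hDB x hx
      have hn := hu.2
      have hn' := hu'.2
      have hn'' := hu''.2
      simp only [List.mem_cons, not_or, List.not_mem_nil] at hn hn' hn''
      exact false_of_cycle hB x z₂ u z₁ u' z₄ u'' z₃ (by grind (splits := 40))
        ⟨hblueD x hx z₂ h2, b2.symm, b1, b1'.symm, b4', b4''.symm, b3'', (hblueD x hx z₃ h3).symm⟩
    · obtain ⟨c, hc, c', hc', hcc'⟩ := Finset.one_lt_card.1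
        (hpick B [z₂, z₃] 2 (by simp; omega))
      rw [Finset.mem_sdiff, List.mem_toFinset] at hc hc'
      have hn := hc.2
      have hn' := hc'.2
      have e := hRB u hu.1
      have hcB := hc.1
      have hcB' := hc'.1
      have huR := hu.1
      simp only [List.nodup_cons, List.mem_cons, not_or, List.not_mem_nil] at hn hn' hxyw
      exact false_of_cycle hB x z₂ u z₃ y c w c' (by clear hc hc' hu hu'; grind (splits := 40))
        ⟨hblueD x hx z₂ h2, b2.symm, b3, (hblueD y hy z₃ h3).symm, hblueD y hy c hc.1,
          (hblueD w hw c hc.1).symm, hblueD w hw c' hc'.1, (hblueD x hx c' hc'.1).symm⟩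

end Sides

/-! ### Two colors and small parts -/

/-- The vertices are partitioned by `π` into parts with at most three vertices. Vertices of different
parts are joined by a red or a blue edge, and all edges between two given parts have the same colors.
Nothing is assumed about the edges inside the parts. -/
structure PartColored {V ι : Type*} (Red Blue : SimpleGraph V) (π : V → ι) : Prop where
  total : ∀ u v : V, π u ≠ π v → Red.Adj u v ∨ Blue.Adj u v
  red : ∀ u u' w, π u = π u' → π u ≠ π w → Red.Adj u w → Red.Adj u' w
  blue : ∀ u u' w, π u = π u' → π u ≠ π w → Blue.Adj u w → Blue.Adj u' w
  card_le : ∀ D : Finset V, (∀ d ∈ D, ∀ d' ∈ D, π d = π d') → D.card ≤ 3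

/-- The graph `H` together with all edges inside `D`. -/
def fill {V : Type*} (H : SimpleGraph V) (D : Finset V) : SimpleGraph V where
  Adj u v := H.Adj u v ∨ u ≠ v ∧ u ∈ D ∧ v ∈ D
  symm := ⟨fun _ _ h => h.imp (fun h => h.symm) fun h => ⟨h.1.symm, h.2.2, h.2.1⟩⟩
  loopless := ⟨fun _ h => h.elim (fun h => h.ne rfl) fun h => h.1 rfl⟩

lemma fill_adj {V : Type*} {H : SimpleGraph V} {D : Finset V} {u v : V} :
    (fill H D).Adj u v ↔ H.Adj u v ∨ u ≠ v ∧ u ∈ D ∧ v ∈ D := Iff.rfl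

/-- A small target graph is found between `D` and its common neighbors. -/
lemma card_add_card_le {V : Type*} {H : SimpleGraph V} {D R : Finset V} {r : Fin 4}
    (hr : (r : ℕ) ≤ 1) (h : ¬ targetGraph r ⊑ H) (hadj : ∀ d ∈ D, ∀ v ∈ R, H.Adj d v)
    (hDR : ∀ d ∈ D, d ∉ R) (hD2 : 2 ≤ D.card) (hD3 : D.card ≤ 3) : D.card + R.card ≤ r + 3 := by
  by_contra! hlt
  have hR : 1 ≤ R.card := by omega
  obtain ⟨d, hd⟩ := Finset.card_pos.1 (show 0 < D.card by omega)
  obtain ⟨u, hu⟩ := Finset.card_pos.1 hR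
  have h1 : ∀ t, t ≤ R.card → 1 ≤ t → 1 + 2 * t = 2 * (r : ℕ) + 3 → t + 1 ≤ D.card → False :=
    fun t ht ht1 hl hc => h (targetGraph_isContained_of_join (D := D) (X := R) (p := [d]) (t := t)
      (fun x hx hxD => hDR x hxD hx) (fun x hx d hd => (hadj d hd x hx).symm) (by simp) (by simp)
      (by simpa using hd) (by simp) ht ht1 (by simpa using hl) (by simp; omega))
  by_cases hr0 : (r : ℕ) = 0
  · exact h1 1 (by omega) le_rfl (by omega) (by omega)
  by_cases hD : D.card = 3
  · exact h1 2 (by omega) (by omega) (by omega) (by omega)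
  · exact h (targetGraph_isContained_of_join (D := R) (X := D) (p := [u]) (t := 2)
      hDR hadj (by simp) (by simp) (by simpa using hu) (by simp) (by omega) (by omega)
      (by simp; omega) (by simp; omega))

namespace PartColored

variable {V ι : Type*} {Red Blue : SimpleGraph V} {π : V → ι}

lemma symm (h : PartColored Red Blue π) : PartColored Blue Red π :=
  ⟨fun u v huv => (h.total u v huv).symm, h.blue, h.red, h.card_le⟩

lemma fill_left (h : PartColored Red Blue π) {D : Finset V} (hD : ∀ d ∈ D, ∀ d' ∈ D, π d = π d') :
    PartColored (fill Red D) Blue π where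
  total u v huv := (h.total u v huv).imp_left Or.inl
  red u u' w huu' huw := by
    rintro (hadj | ⟨-, hu, hw⟩)
    · exact Or.inl (h.red u u' w huu' huw hadj)
    · exact (huw (hD u hu w hw)).elim
  blue := h.blue
  card_le := h.card_le

open Classical in
lemma sides [Fintype V] (h : PartColored Red Blue π) (x : V) :
    Sides Red Blue (Finset.univ.filter fun v => π v = π x)
      (Finset.univ.filter fun v => π v ≠ π x ∧ Red.Adj x v)
      (Finset.univ.filter fun v => π v ≠ π x ∧ ¬ Red.Adj x v) := by
  have hne : ∀ r b, π r ≠ π x → Red.Adj x r → ¬ Red.Adj x b → π r ≠ π b := by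
    intro r b hr hxr hxb hrb
    exact hxb (h.red r b x hrb hr hxr.symm).symm
  constructor
  · simp only [Finset.mem_filter, Finset.mem_univ, true_and]
    exact fun d hd r hr => h.red x d r hd.symm hr.1.symm hr.2
  · simp only [Finset.mem_filter, Finset.mem_univ, true_and]
    exact fun d hd b hb => h.blue x d b hd.symm hb.1.symm
      ((h.total x b hb.1.symm).resolve_left hb.2)
  · simp only [Finset.mem_filter, Finset.mem_univ, true_and]
    exact fun d hd b hb hdb => hb.2 (h.red d x b hd (hd ▸ hb.1.symm) hdb)
  · simp only [Finset.mem_filter, Finset.mem_univ, true_and]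
    intro v
    tauto
  · simp only [Finset.mem_filter, Finset.mem_univ, true_and]
    exact fun r hr b hb => h.total r b (hne r b hr.1 hr.2 hb.2)
  · simp only [Finset.mem_filter, Finset.mem_univ, true_and]
    intro r hr r' hr' _ b hb hbr hbr'
    refine h.total r r' fun hrr' => hbr' ?_
    exact (h.red r r' b hrr' (hne r b hr.1 hr.2 hb.2) hbr.symm).symm
  · simp only [Finset.mem_filter, Finset.mem_univ, true_and]
    exact fun d hd hr => hr.1 hd
  · simp only [Finset.mem_filter, Finset.mem_univ, true_and]
    exact fun d hd hr => hr.1 hd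
  · simp only [Finset.mem_filter, Finset.mem_univ, true_and]
    exact fun r hr hb => hb.2 hr.2

end PartColored

lemma fill_cycle {V : Type*} {H : SimpleGraph V} {D : Finset V} (h : targetGraph 3 ⊑ fill H D) :
    ∃ f : Fin 8 → V, Function.Injective f ∧
      ∀ i, H.Adj (f i) (f (i + 1)) ∨ (f i ∈ D ∧ f (i + 1) ∈ D) := by
  obtain ⟨f, hf, hadj⟩ := exists_of_cycleGraph_eight_isContained h
  exact ⟨f, hf, fun i => (fill_adj.1 (hadj i)).imp_right fun h => h.2⟩

namespace PartColored

variable {V ι : Type*} {Red Blue : SimpleGraph V} {π : V → ι}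

/-- An uncolored edge `x y` is impossible if filling its part in either color creates a target
graph. -/
lemma false_of_fill [Fintype V] (h : PartColored Red Blue π) {r b : Fin 4} (hr : r ≠ 2) (hb : b ≠ 2)
    (hV : (r : ℕ) + b + 5 ≤ Fintype.card V) {x y : V} (hxy : x ≠ y) (hπ : π x = π y)
    (hR : ¬ targetGraph r ⊑ Red) (hB : ¬ targetGraph b ⊑ Blue)
    {D : Finset V} (hD : ∀ v, v ∈ D ↔ π v = π x)
    (hR' : targetGraph r ⊑ fill Red D) (hB' : targetGraph b ⊑ fill Blue D) : False := by
  classical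
  have S := h.sides x
  have S' := h.symm.sides x
  obtain rfl : D = Finset.univ.filter fun v => π v = π x := by ext; simp [hD]
  set D := Finset.univ.filter fun v => π v = π x with hDdef
  set R := Finset.univ.filter fun v => π v ≠ π x ∧ Red.Adj x v
  set B := Finset.univ.filter fun v => π v ≠ π x ∧ ¬ Red.Adj x v
  set R' := Finset.univ.filter fun v => π v ≠ π x ∧ Blue.Adj x v
  set B' := Finset.univ.filter fun v => π v ≠ π x ∧ ¬ Blue.Adj x v
  have hD3 : D.card ≤ 3 := h.card_le D fun d hd d' hd' => by
    rw [(hD d).1 hd, (hD d').1 hd']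
  have hD2 : 2 ≤ D.card := Finset.one_lt_card.2 ⟨x, (hD x).2 rfl, y, (hD y).2 hπ.symm, hxy⟩
  have hBR' : B.card ≤ R'.card := Finset.card_le_card fun v hv => by
    simp only [B, R', Finset.mem_filter, Finset.mem_univ, true_and] at hv ⊢
    exact ⟨hv.1, (h.total x v hv.1.symm).resolve_left hv.2⟩
  have hB'R : B'.card ≤ R.card := Finset.card_le_card fun v hv => by
    simp only [B', R, Finset.mem_filter, Finset.mem_univ, true_and] at hv ⊢
    exact ⟨hv.1, (h.total x v hv.1.symm).resolve_right hv.2⟩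
  have hcov : ∀ {E F : Finset V}, (∀ v, v ∈ D ∨ v ∈ E ∨ v ∈ F) →
      Fintype.card V ≤ D.card + E.card + F.card := by
    intro E F hEF
    rw [← Finset.card_univ]
    refine (Finset.card_le_card fun v _ => ?_).trans ((Finset.card_union_le (D ∪ E) F).trans
      (Nat.add_le_add_right (Finset.card_union_le D E) _))
    simpa [or_assoc] using hEF v
  have hn := hcov S.cover
  have hn' := hcov S'.cover
  by_cases hr3 : r = 3
  · subst hr3
    obtain ⟨f, hf, hfadj⟩ := fill_cycle hR'
    by_cases hb3 : b = 3
    · subst hb3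
      have h3 : ((3 : Fin 4) : ℕ) = 3 := rfl
      rw [h3] at hV
      by_cases h7 : 7 ≤ D.card + R.card
      · exact S.false_of_filled_cycle hR hB hD3 h7 (by omega) hf hfadj
      · obtain ⟨f', hf', hfadj'⟩ := fill_cycle hB'
        exact S'.false_of_filled_cycle hB hR hD3 (by omega) (by omega) hf' hfadj'
    · have h5 := S.five_le_card_add_card hR hD3 hf hfadj
      have h4 := card_add_card_le (r := b) (by omega) hB S'.red S'.disjDR hD2 hD3
      omega
  · have h4 := card_add_card_le (r := r) (by omega) hR S.red S.disjDR hD2 hD3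
    by_cases hb3 : b = 3
    · subst hb3
      obtain ⟨f, hf, hfadj⟩ := fill_cycle hB'
      have h5 := S'.five_le_card_add_card hB hD3 hf hfadj
      omega
    · have h4' := card_add_card_le (r := b) (by omega) hB S'.red S'.disjDR hD2 hD3
      omega

open Classical in
/-- The number of ordered pairs of vertices without color. -/
noncomputable def uncolored [Fintype V] (Red Blue : SimpleGraph V) : ℕ :=
  (Finset.univ.filter fun p : V × V => p.1 ≠ p.2 ∧ ¬ Red.Adj p.1 p.2 ∧ ¬ Blue.Adj p.1 p.2).card

lemma uncolored_fill_lt [Fintype V] {x y : V} (hxy : x ≠ y) (hR : ¬ Red.Adj x y) (hB : ¬ Blue.Adj x y)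
    {D : Finset V} (hx : x ∈ D) (hy : y ∈ D) : uncolored (fill Red D) Blue < uncolored Red Blue := by
  classical
  refine Finset.card_lt_card ⟨fun p hp => ?_, fun hsub => ?_⟩
  · simp only [Finset.mem_filter, Finset.mem_univ, true_and, fill_adj] at hp ⊢
    tauto
  · have := hsub (show (x, y) ∈ _ by simp [hxy, hR, hB])
    simp [fill_adj, hxy, hx, hy] at this

lemma uncolored_comm [Fintype V] : uncolored Red Blue = uncolored Blue Red := by
  unfold uncolored
  congr 1
  ext p
  simp only [Finset.mem_filter]
  tauto

/-- Induction on the number of uncolored edges: coloring the edges inside a part, in red or in blue,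
leaves fewer of them, and the two target graphs that arise are played off against each other. -/
theorem exists_target_of_ne_two [Fintype V] {r b : Fin 4} (hr : r ≠ 2) (hb : b ≠ 2)
    (hV : (r : ℕ) + b + 5 ≤ Fintype.card V) (h : PartColored Red Blue π) :
    targetGraph r ⊑ Red ∨ targetGraph b ⊑ Blue := by
  classical
  induction hm : uncolored Red Blue using Nat.strong_induction_on generalizing Red Blue with
  | _ m ih =>
  by_contra hcon
  have hcon' := not_or.1 hcon
  by_cases htot : ∀ u v, u ≠ v → Red.Adj u v ∨ Blue.Adj u v
  · exact hcon (exists_target_of_two_colors htot hr hb hV)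
  push Not at htot
  obtain ⟨x, y, hxy, hRxy, hBxy⟩ := htot
  have hπ : π x = π y := by
    by_contra hne
    exact not_or.2 ⟨hRxy, hBxy⟩ (h.total x y hne)
  set D := Finset.univ.filter fun v => π v = π x with hDdef
  have hD : ∀ v, v ∈ D ↔ π v = π x := by simp [hDdef]
  have hDD : ∀ d ∈ D, ∀ d' ∈ D, π d = π d' := fun d hd d' hd' => by
    rw [(hD d).1 hd, (hD d').1 hd']
  have hx := (hD x).2 rfl
  have hy := (hD y).2 hπ.symm
  refine h.false_of_fill hr hb hV hxy hπ hcon'.1 hcon'.2 hD ?_ ?_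
  · exact (ih _ (hm ▸ uncolored_fill_lt hxy hRxy hBxy hx hy) (h.fill_left hDD) rfl).resolve_right
      hcon'.2
  · refine (ih (uncolored Red (fill Blue D)) ?_ (h.symm.fill_left hDD).symm rfl).resolve_left hcon'.1
    rw [← hm, uncolored_comm, uncolored_comm (Red := Red)]
    exact uncolored_fill_lt hxy hBxy hRxy hx hy

end PartColored

/-! ### Adding a vertex to reduce `P₇` to `C₈` -/

/-- The graph `H` with a new vertex `none` that is adjacent to all others. -/
def cone {V : Type*} (H : SimpleGraph V) : SimpleGraph (Option V) where
  Adj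
    | none, none => False
    | some u, some v => H.Adj u v
    | _, _ => True
  symm := ⟨fun u v h => by cases u <;> cases v <;> first | exact h | exact SimpleGraph.Adj.symm h⟩
  loopless := ⟨fun u h => by cases u with | none => exact h | some u => exact h.ne rfl⟩

/-- A cycle on eight vertices in the cone leaves a path on seven vertices after the deletion of the
apex. -/
lemma pathGraph_seven_of_cone {V : Type*} {H : SimpleGraph V} (h : targetGraph 3 ⊑ cone H) :
    targetGraph 2 ⊑ H := by
  obtain ⟨f, hf, hadj⟩ := exists_of_cycleGraph_eight_isContained h
  obtain ⟨i₀, hi₀⟩ : ∃ i₀, ∀ i, i ≠ i₀ → f i ≠ none := by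
    by_cases hex : ∃ i, f i = none
    · obtain ⟨i₀, hi₀⟩ := hex
      exact ⟨i₀, fun i hi hn => hi (hf (hn.trans hi₀.symm))⟩
    · push Not at hex
      exact ⟨0, fun i _ => hex i⟩
  have hsome : ∀ j : Fin 7, ∃ v, f (i₀ + j.succ) = some v := fun j =>
    Option.ne_none_iff_exists'.1 (hi₀ _ (by simp))
  choose g hg using hsome
  have hadj' : ∀ a b : Fin 7, (a : ℕ) + 1 = b → H.Adj (g a) (g b) := by
    intro a b hab
    have h1 := hadj (i₀ + a.succ)
    have h2 : a.succ + 1 = b.succ := by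
      clear h1
      revert a b
      decide
    rw [add_assoc, h2, hg, hg] at h1
    exact h1
  refine ⟨⟨⟨g, fun {a b} hab => ?_⟩, fun a b hab => ?_⟩⟩
  · rcases pathGraph_adj.1 hab with h | h
    · exact hadj' a b h
    · exact (hadj' b a h).symm
  · exact Fin.succ_injective 7 (add_left_cancel (hf ((hg a).trans
      ((congrArg some hab).trans (hg b).symm))))

lemma exists_pathGraph_adj (n : ℕ) (v : Fin (n + 2)) : ∃ w, (pathGraph (n + 2)).Adj v w := by
  by_cases hv : (v : ℕ) = 0
  · exact ⟨1, pathGraph_adj.2 (Or.inl (by simp [hv]))⟩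
  · exact ⟨⟨v - 1, by omega⟩, pathGraph_adj.2 (Or.inr (by simp; omega))⟩

lemma exists_cycleGraph_adj (v : Fin 8) : ∃ w, (cycleGraph 8).Adj v w :=
  ⟨v + 1, cycleGraph_adj.2 (Or.inr (add_sub_cancel_left v 1))⟩

lemma exists_targetGraph_adj : ∀ (b : Fin 4) (v : Fin (targetOrder b)),
    ∃ w, (targetGraph b).Adj v w
  | 0, v => exists_pathGraph_adj 1 v
  | 1, v => exists_pathGraph_adj 3 v
  | 2, v => exists_pathGraph_adj 5 v
  | 3, v => exists_cycleGraph_adj v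

/-- An isolated vertex does not help to find a target graph. -/
lemma targetGraph_of_map_some {V : Type*} {H : SimpleGraph V} {b : Fin 4}
    (h : targetGraph b ⊑ H.map Function.Embedding.some) : targetGraph b ⊑ H := by
  obtain ⟨f⟩ := h
  have hsome : ∀ v, ∃ u, f v = some u := fun v => by
    obtain ⟨w, hw⟩ := exists_targetGraph_adj b v
    obtain ⟨u, -, -, hu, -⟩ := (SimpleGraph.map_adj _ _ _ _).1 (f.toHom.map_adj hw)
    exact ⟨u, hu.symm⟩
  choose g hg using hsome
  refine ⟨⟨⟨g, fun {a c} hac => ?_⟩, fun a c hac => ?_⟩⟩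
  · have := f.toHom.map_adj hac
    change (H.map Function.Embedding.some).Adj (f a) (f c) at this
    rw [hg, hg] at this
    exact (SimpleGraph.map_adj_apply (f := Function.Embedding.some)).1 this
  · exact f.injective ((hg a).trans ((congrArg some hac).trans (hg c).symm))

namespace PartColored

variable {V ι : Type*} {Red Blue : SimpleGraph V} {π : V → ι}

lemma cone (h : PartColored Red Blue π) :
    PartColored (cone Red) (Blue.map Function.Embedding.some) (Option.map π) := by
  have hmap : ∀ u v, (Blue.map Function.Embedding.some).Adj (some u) (some v) ↔ Blue.Adj u v :=
    fun u v => SimpleGraph.map_adj_apply (f := Function.Embedding.some)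
  have hnone : ∀ v, ¬ (Blue.map Function.Embedding.some).Adj none v := fun v hv => by
    obtain ⟨u, -, -, hu, -⟩ := (SimpleGraph.map_adj _ _ _ _).1 hv
    cases hu
  constructor
  · rintro (_ | u) (_ | v) huv
    · exact (huv rfl).elim
    · exact Or.inl trivial
    · exact Or.inl trivial
    · exact (h.total u v fun he => huv (congrArg some he)).imp_right (hmap u v).2
  · rintro (_ | u) (_ | u') (_ | w) huu' huw hadj
    all_goals first
      | exact hadj
      | exact trivial
      | exact (huw rfl).elim
      | cases huu'
      | exact h.red u u' w (Option.some.inj huu') (fun he => huw (congrArg some he)) hadj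
  · rintro (_ | u) (_ | u') (_ | w) huu' huw hadj
    all_goals first
      | exact hadj
      | exact (huw rfl).elim
      | cases huu'
      | exact (hmap _ _).2 (h.blue u u' w (Option.some.inj huu') (fun he => huw (congrArg some he))
          ((hmap _ _).1 hadj))
      | exact (hnone _ hadj.symm).elim
  · intro D hD
    classical
    by_cases hn : none ∈ D
    · have : D ⊆ {none} := fun d hd => by
        have := hD none hn d hd
        cases d with
        | none => simp
        | some d => cases this
      exact (Finset.card_le_card this).trans (by simp)
    · have hD' : D = (Finset.eraseNone D).map Function.Embedding.some := by
        rw [Finset.map_some_eraseNone, Finset.erase_eq_of_notMem hn]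
      rw [hD', Finset.card_map]
      refine h.card_le _ fun d hd d' hd' => ?_
      exact Option.some.inj (hD (some d) (by simpa using hd) (some d') (by simpa using hd'))

/-- For `G₂ = P₇` add a vertex with red edges to all others and look for `G₃ = C₈`. -/
lemma exists_target_left [Fintype V] {r b : Fin 4} (hb : b ≠ 2) (hV : (r : ℕ) + b + 5 ≤ Fintype.card V)
    (h : PartColored Red Blue π) : targetGraph r ⊑ Red ∨ targetGraph b ⊑ Blue := by
  by_cases hr : r = 2
  · subst hr
    refine (h.cone.exists_target_of_ne_two (r := 3) (b := b) (by decide) hb ?_).imp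
      pathGraph_seven_of_cone targetGraph_of_map_some
    have h2 : ((2 : Fin 4) : ℕ) = 2 := rfl
    have h3 : ((3 : Fin 4) : ℕ) = 3 := rfl
    rw [Fintype.card_option]
    omega
  · exact h.exists_target_of_ne_two hr hb hV

/-- The two-color Ramsey theorem for colorings with small uncolored parts. -/
theorem exists_target [Fintype V] {r b : Fin 4} (hV : (r : ℕ) + b + 5 ≤ Fintype.card V)
    (h : PartColored Red Blue π) : targetGraph r ⊑ Red ∨ targetGraph b ⊑ Blue := by
  by_cases hb : b = 2
  · subst hb
    by_cases hr : r = 2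
    · subst hr
      refine ((h.symm.cone.symm).exists_target_left (r := 2) (b := 3) (by decide) ?_).imp
        targetGraph_of_map_some pathGraph_seven_of_cone
      have h2 : ((2 : Fin 4) : ℕ) = 2 := rfl
      have h3 : ((3 : Fin 4) : ℕ) = 3 := rfl
      rw [Fintype.card_option]
      omega
    · exact (h.symm.exists_target_left hr (by omega)).symm
  · exact h.exists_target_left hb hV

end PartColored

/-! ### The induction on the sum of the indices -/

namespace GallaiColoring

/-- Two vertices are close if they lie in a common module with at most three vertices. -/
def Close {V K : Type*} (c : GallaiColoring V K) (u v : V) : Prop :=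
  ∃ D : Finset V, c.IsModule D ∧ D.card ≤ 3 ∧ u ∈ D ∧ v ∈ D

variable {V K : Type*} {c : GallaiColoring V K}

lemma isModule_singleton (c : GallaiColoring V K) (u : V) : c.IsModule {u} := by
  intro w _ d hd d' hd'
  rw [Finset.mem_singleton.1 hd, Finset.mem_singleton.1 hd']

/-- The union of two small modules that meet has at most five vertices, so it is a proper module and
hence small again. -/
lemma isModule_union_card_le [Fintype V] [DecidableEq V] (hV : 6 ≤ Fintype.card V)
    (hmod : ∀ D : Finset V, c.IsModule D → D ≠ Finset.univ → D.card ≤ 3) {D E : Finset V}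
    (hD : c.IsModule D) (hE : c.IsModule E) (hD3 : D.card ≤ 3) (hE3 : E.card ≤ 3) {z : V}
    (hzD : z ∈ D) (hzE : z ∈ E) : c.IsModule (D ∪ E) ∧ (D ∪ E).card ≤ 3 := by
  have hDE := IsModule.union c hD hE hzD hzE
  refine ⟨hDE, hmod _ hDE fun huniv => ?_⟩
  have h1 := Finset.card_union_add_card_inter D E
  have h2 : 0 < (D ∩ E).card := Finset.card_pos.2 ⟨z, Finset.mem_inter.2 ⟨hzD, hzE⟩⟩
  rw [huniv, Finset.card_univ] at h1
  omega

lemma equivalence_close [Fintype V] (hV : 6 ≤ Fintype.card V)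
    (hmod : ∀ D : Finset V, c.IsModule D → D ≠ Finset.univ → D.card ≤ 3) :
    Equivalence c.Close := by
  classical
  refine ⟨fun u => ⟨{u}, c.isModule_singleton u, by simp, by simp, by simp⟩, ?_, ?_⟩
  · rintro u v ⟨D, hD, hD3, hu, hv⟩
    exact ⟨D, hD, hD3, hv, hu⟩
  · rintro u v w ⟨D, hD, hD3, hu, hv⟩ ⟨E, hE, hE3, hv', hw⟩
    obtain ⟨h1, h2⟩ := isModule_union_card_le hV hmod hD hE hD3 hE3 hv hv'
    exact ⟨D ∪ E, h1, h2, Finset.mem_union_left _ hu, Finset.mem_union_right _ hw⟩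

/-- Pairwise close vertices all lie in one maximal module among those with at most three
vertices. -/
lemma card_le_of_close [Fintype V] (hV : 6 ≤ Fintype.card V)
    (hmod : ∀ D : Finset V, c.IsModule D → D ≠ Finset.univ → D.card ≤ 3) (D : Finset V)
    (hD : ∀ d ∈ D, ∀ d' ∈ D, c.Close d d') : D.card ≤ 3 := by
  classical
  rcases D.eq_empty_or_nonempty with rfl | ⟨d₀, hd₀⟩
  · simp
  obtain ⟨M, hM, hmax⟩ := Finset.exists_max_image
    (Finset.univ.filter fun M : Finset V => c.IsModule M ∧ M.card ≤ 3 ∧ d₀ ∈ M) Finset.card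
    ⟨{d₀}, by simp [c.isModule_singleton d₀]⟩
  simp only [Finset.mem_filter, Finset.mem_univ, true_and] at hM hmax
  refine (Finset.card_le_card fun d hd => ?_).trans hM.2.1
  obtain ⟨E, hE, hE3, hd₀E, hdE⟩ := hD d₀ hd₀ d hd
  obtain ⟨h1, h2⟩ := isModule_union_card_le hV hmod hM.1 hE hM.2.1 hE3 hM.2.2 hd₀E
  have heq := Finset.eq_of_subset_of_card_le (Finset.subset_union_left (s₁ := M) (s₂ := E))
    (hmax _ ⟨h1, h2, Finset.mem_union_left _ hM.2.2⟩)
  rw [heq]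
  exact Finset.mem_union_right _ hdE

lemma col_eq_of_close {u u' w : V} (h : c.Close u u') (hw : ¬ c.Close u w) :
    c.col u w = c.col u' w := by
  obtain ⟨D, hD, hD3, hu, hu'⟩ := h
  rw [c.symm u, c.symm u']
  exact hD w (fun hwD => hw ⟨D, hD, hD3, hu, hwD⟩) u hu u' hu'

/-- The edges between vertices that are not close have colors whose graphs are connected, since a
component of another color is a proper module. -/
lemma preconnected_of_not_close [Fintype V]
    (hmod : ∀ D : Finset V, c.IsModule D → D ≠ Finset.univ → D.card ≤ 3) {u v : V} (huv : u ≠ v)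
    (h : ¬ c.Close u v) : (c.graph (c.col u v)).Preconnected := by
  classical
  have hu : u ∈ Finset.univ.filter fun y => (c.graph (c.col u v)).Reachable u y := by simp
  have hv : v ∈ Finset.univ.filter fun y => (c.graph (c.col u v)).Reachable u y := by
    simpa using Adj.reachable (c.graph_adj.2 ⟨huv, rfl⟩)
  have hm := c.isModule_reachable (c.col u v) u
  have huniv : (Finset.univ.filter fun y => (c.graph (c.col u v)).Reachable u y) = Finset.univ := by
    by_contra hne
    refine h ⟨_, hm, ?_, ?_, ?_⟩
    · convert hmod _ hm ?_
      convert hne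
    · convert hu
    · convert hv
  intro x y
  have hx : x ∈ Finset.univ.filter fun y => (c.graph (c.col u v)).Reachable u y := by
    rw [huniv]; exact Finset.mem_univ x
  have hy : y ∈ Finset.univ.filter fun y => (c.graph (c.col u v)).Reachable u y := by
    rw [huniv]; exact Finset.mem_univ y
  exact ((Finset.mem_filter.1 hx).2.symm).trans (Finset.mem_filter.1 hy).2

end GallaiColoring

/-- The bound for Gallai colorings. In a minimal counterexample all proper modules have at most
three vertices, and two connected colors occur between the classes of close vertices. -/
theorem exists_target_of_gallaiColoring {K : Type*} [Fintype K] (N : ℕ) :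
    ∀ (V : Type) [Fintype V] (c : GallaiColoring V K) (i : K → Fin 4), ∑ j, (i j : ℕ) = N →
      N + 5 ≤ Fintype.card V → ∃ j, targetGraph (i j) ⊑ c.graph j := by
  classical
  induction N using Nat.strong_induction_on with
  | _ N ih =>
  intro V _ c i hN hV
  by_contra! hno
  have hno' : ∀ j, ¬ targetGraph (i j) ⊑ c.graph j := fun j hj =>
    (not_nonempty_iff.2 (hno j)) hj
  have hmod : ∀ D : Finset V, c.IsModule D → D ≠ Finset.univ → D.card ≤ 3 := by
    intro D hD hne
    by_contra! h4
    obtain ⟨j, hj⟩ := exists_target_of_isModule c i (hN ▸ hV)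
      (fun W _ c' i' hlt hW => ih _ (hN ▸ hlt) W c' i' rfl hW) hD hne h4
    exact hno' j hj
  rcases Nat.eq_zero_or_pos N with hN0 | hNpos
  · -- Any triangle contains a path on three vertices in one color.
    have hi0 : ∀ j, i j = 0 := fun j => Fin.ext (by
      have := Finset.single_le_sum (f := fun j => (i j : ℕ)) (fun _ _ => Nat.zero_le _)
        (Finset.mem_univ j)
      have h0 : ((0 : Fin 4) : ℕ) = 0 := rfl
      omega)
    have hpath : ∀ a b d : V, a ≠ b → b ≠ d → a ≠ d → c.col a b ≠ c.col b d := by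
      intro a b d hab hbd had heq
      refine hno' (c.col a b) ?_
      rw [hi0]
      refine pathGraph_isContained_iff.2 ⟨[a, b, d], by simp [hab, hbd, had], ?_, rfl⟩
      simp [c.graph_adj, hab, hbd, heq]
    obtain ⟨x, y, z, hxy, hxz, hyz⟩ := Fintype.two_lt_card_iff.1 (show 2 < Fintype.card V by omega)
    rcases c.gallai x y z hxy hyz hxz with h | h | h
    · exact hpath x y z hxy hyz hxz h
    · exact hpath y z x hyz hxz.symm hxy.symm (h.trans (c.symm _ _))
    · exact hpath y x z hxy.symm hxz hyz ((c.symm _ _).trans h)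
  have hV6 : 6 ≤ Fintype.card V := by omega
  let s : Setoid V := ⟨c.Close, GallaiColoring.equivalence_close hV6 hmod⟩
  let π : V → Quotient s := Quotient.mk s
  have hπ : ∀ u v, π u = π v ↔ c.Close u v := fun u v => Quotient.eq (r := s)
  have hinv : ∀ a : K, ∀ u u' w, π u = π u' → π u ≠ π w → (c.graph a).Adj u w →
      (c.graph a).Adj u' w := by
    intro a u u' w huu' huw hadj
    refine c.graph_adj.2 ⟨fun he => huw (huu'.trans (congrArg π he)), ?_⟩
    rw [← GallaiColoring.col_eq_of_close ((hπ _ _).1 huu') fun h => huw ((hπ _ _).2 h)]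
    exact hadj.2
  have hcard : ∀ D : Finset V, (∀ d ∈ D, ∀ d' ∈ D, π d = π d') → D.card ≤ 3 := fun D hD =>
    GallaiColoring.card_le_of_close hV6 hmod D fun d hd d' hd' => (hπ _ _).1 (hD d hd d' hd')
  have hpre : ∀ u v, π u ≠ π v → (c.graph (c.col u v)).Preconnected := fun u v huv =>
    GallaiColoring.preconnected_of_not_close hmod (fun h => huv (congrArg π h))
      fun h => huv ((hπ _ _).2 h)
  have hne : ∀ u v, π u ≠ π v → u ≠ v := fun u v huv h => huv (congrArg π h)
  by_cases htwo : ∃ r b, r ≠ b ∧ (c.graph r).Preconnected ∧ (c.graph b).Preconnected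
  · obtain ⟨r, b, hrb, hr, hb⟩ := htwo
    have hP : PartColored (c.graph r) (c.graph b) π := by
      refine ⟨fun u v huv => ?_, hinv r, hinv b, hcard⟩
      by_contra! hcon
      have h1 : r ≠ c.col u v := fun h => hcon.1 ⟨hne u v huv, h.symm⟩
      have h2 : b ≠ c.col u v := fun h => hcon.2 ⟨hne u v huv, h.symm⟩
      exact exists_not_preconnected hrb h2 h1 (Fintype.card V - 2) V c (by omega) hr hb
        (hpre u v huv)
    have hsum : (i r : ℕ) + i b ≤ N := by
      rw [← hN, ← Finset.sum_pair (f := fun j => (i j : ℕ)) hrb]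
      exact Finset.sum_le_sum_of_subset (Finset.subset_univ _)
    rcases hP.exists_target (r := i r) (b := i b) (by omega) with h | h
    · exact hno' r h
    · exact hno' b h
  · push Not at htwo
    obtain ⟨r, hr⟩ : ∃ r, ∀ a, (c.graph a).Preconnected → a = r := by
      by_cases hone : ∃ r, (c.graph r).Preconnected
      · obtain ⟨r, hr⟩ := hone
        exact ⟨r, fun a ha => by_contra fun h => htwo a r h ha hr⟩
      · obtain ⟨x⟩ : Nonempty V := Fintype.card_pos_iff.1 (by omega)
        exact ⟨c.col x x, fun a ha => (hone ⟨a, ha⟩).elim⟩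
    have hP : PartColored (c.graph r) ⊥ π :=
      ⟨fun u v huv => Or.inl ⟨hne u v huv, hr _ (hpre u v huv)⟩, hinv r,
        fun u u' w _ _ h => h.elim, hcard⟩
    have hle : (i r : ℕ) ≤ N :=
      hN ▸ Finset.single_le_sum (f := fun j => (i j : ℕ)) (fun _ _ => Nat.zero_le _)
        (Finset.mem_univ r)
    rcases hP.exists_target (r := i r) (b := 0) (by
      have h0 : ((0 : Fin 4) : ℕ) = 0 := rfl
      omega) with h | ⟨⟨f⟩⟩
    · exact hno' r h
    · obtain ⟨w, hw⟩ := exists_targetGraph_adj 0 ⟨0, by decide⟩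
      exact f.toHom.map_adj hw

/-! ### Edge labelings of complete graphs -/

/-- An edge labeling of a complete graph without rainbow triangles, as a function of two vertices;
the value `a₀` fills the diagonal. -/
def gallaiColoringOfLabeling {V K : Type*} [DecidableEq V] (c : TopEdgeLabeling V K) (a₀ : K)
    (hc : ¬ HasRainbowCopy (completeGraph (Fin 3)) c) : GallaiColoring V K where
  col u v := if h : u ≠ v then c.get u v h else a₀
  symm u v := by
    by_cases h : u = v
    · subst h; rfl
    · rw [dif_pos h, dif_pos (Ne.symm h)]
      exact EdgeLabeling.get_comm v u h
  gallai x y z hxy hyz hxz := by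
    by_contra hcon
    rw [dif_pos hxy, dif_pos hyz, dif_pos hxz, not_or, not_or] at hcon
    obtain ⟨h1, h2, h3⟩ := hcon
    have hinj : Function.Injective ![x, y, z] := by
      intro a b hab
      fin_cases a <;> fin_cases b <;> simp_all [eq_comm]
    refine hc ⟨⟨⟨![x, y, z], fun hab => hinj.ne hab.ne⟩, hinj⟩, ?_⟩
    have hedge : ∀ e : Sym2 (Fin 3), ¬ e.IsDiag → e = s(0, 1) ∨ e = s(1, 2) ∨ e = s(0, 2) := by
      decide
    rintro ⟨e, he⟩ ⟨e', he'⟩ h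
    rcases hedge e (SimpleGraph.not_isDiag_of_mem_edgeSet _ he) with rfl | rfl | rfl <;>
      rcases hedge e' (SimpleGraph.not_isDiag_of_mem_edgeSet _ he') with rfl | rfl | rfl
    · rfl
    · exact absurd h h1
    · exact absurd h h3
    · exact absurd h.symm h1
    · rfl
    · exact absurd h h2
    · exact absurd h.symm h3
    · exact absurd h.symm h2
    · rfl

lemma gallaiColoringOfLabeling_graph {V K : Type*} [DecidableEq V] (c : TopEdgeLabeling V K)
    (a₀ : K) (hc : ¬ HasRainbowCopy (completeGraph (Fin 3)) c) (a : K) :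
    (gallaiColoringOfLabeling c a₀ hc).graph a = c.labelGraph a := by
  ext u v
  rw [GallaiColoring.graph_adj, TopEdgeLabeling.labelGraph_adj]
  constructor
  · rintro ⟨huv, h⟩
    exact ⟨huv, (dif_pos huv).symm.trans h⟩
  · rintro ⟨huv, h⟩
    exact ⟨huv, (dif_pos huv).trans h⟩

end GallaiRamsey

theorem theorem6 (k : ℕ) (hk : 1 ≤ k) (i : Fin k → Fin 4) :
    gallaiRamsey (SimpleGraph.completeGraph (Fin 3)) (fun j : Fin k => targetGraph (i j)) ≤
      (((∑ j : Fin k, (i j : ℕ)) + 5 : ℕ) : ℕ∞) := by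
  refine sInf_le ⟨_, fun n hn c => ?_, rfl⟩
  by_cases hc : HasRainbowCopy (SimpleGraph.completeGraph (Fin 3)) c
  · exact Or.inl hc
  · obtain ⟨j, hj⟩ := GallaiRamsey.exists_target_of_gallaiColoring _ (Fin n)
      (GallaiRamsey.gallaiColoringOfLabeling c ⟨0, hk⟩ hc) i rfl (by simpa using hn)
    rw [GallaiRamsey.gallaiColoringOfLabeling_graph] at hj
    exact Or.inr ⟨j, hj⟩
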